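/- Let $\gamma=(1+\sqrt5)/2$. Call a real number $\xi$ *extremal* if it is neither rational nor quadratic irrational and there is a constant $c>0$ such that, for every real $X\ge 1$, the inequalities $$|x_0|\le X,\qquad |x_0\xi-x_1|\le cX^{-1/\gamma},\qquad |x_0\xi^2-x_2|\le cX^{-1/\gamma}$$ have a solution $(x_0,x_1,x_2)\in\mathbf Z^3\setminus\{0\}$. Let $\xi$ be an extremal real number. (a) There exists a constant $c>0$, depending only on $\xi$, such that for every real $X\ge1$ the inequalities $$|x_0|\le X,\qquad |x_1|\le X,\qquad |x_0\xi^2+x_1\xi+x_2|\le cX^{-\gamma^2}\tag{1}$$ have a nonzero solution $(x_0,x_1,x_2)\in\mathbf Z^3$. (b) Moreover, for large $X$ solutions are given by the following quadratic polynomials. For $\mathbf x=(x_0,x_1,x_2)\in\mathbf Z^3$ put $\|\mathbf x\|=\max_i|x_i|$, $L(\mathbf x)=\max\{|x_0\xi-x_1|,|x_0\xi^2-x_2|\}$ and $\det(\mathbf x)=x_0x_2-x_1^2$. There exist a strictly increasing sequence of positive integers $(Y_k)_{k\ge1}$ and a sequence $(\mathbf y_k)_{k\ge1}$ of points $\mathbf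 y_k=(y_{k,0},y_{k,1},y_{k,2})$ of $\mathbf Z^3$ such that, for all $k\ge1$, $$Y_{k+1}\sim Y_k^{\gamma},\quad \|\mathbf y_k\|\sim Y_k,\quad L(\mathbf y_k)\sim Y_k^{-1},\quad 1\le|\det(\mathbf y_k)|\ll1,\quad 1\le|\det(\mathbf y_k,\mathbf y_{k+1},\mathbf y_{k+2})|\ll1,\tag{2}$$ where the constants implied in $\ll$ and $\sim$ do not depend on $k$. For any two such sequences satisfying (2), put $$Q_k(T)=\begin{vmatrix}1&T&T^2\\ y_{k,0}&y_{k,1}&y_{k,2}\\ y_{k+1,0}&y_{k+1,1}&y_{k+1,2}\end{vmatrix}\in\mathbf Z[T].$$ Then there are constants $c>0$ and $X_0\ge1$ such that, for every real $X\ge X_0$, there is an index $k\ge1$ for which $Q_k(T)=x_0T^2+x_1T+x_2$ has degree exactly $2$ and its coefficients $(x_0,x_1,x_2)$ satisfy (1). -/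

import Mathlib

namespace Roy

/-- A quadratic irrational: an irrational real number that is a root of an integral
polynomial of degree 2. -/
def IsQuadraticIrrational (ξ : ℝ) : Prop :=
  Irrational ξ ∧ ∃ P : Polynomial ℤ, P.natDegree = 2 ∧ Polynomial.aeval ξ P = 0

/-- `L_ξ(x) = max (|x₀ ξ - x₁|, |x₀ ξ² - x₂|)`. -/
noncomputable def L (ξ : ℝ) (x : Fin 3 → ℤ) : ℝ :=
  max |(x 0 : ℝ) * ξ - x 1| |(x 0 : ℝ) * ξ ^ 2 - x 2|

/-- An extremal real number: neither rational nor quadratic irrational, and, for some `c > 0`,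
for every real `X ≥ 1` there is a nonzero integer point with `|x₀| ≤ X`,
`|x₀ ξ - x₁| ≤ c X^(-1/γ)` and `|x₀ ξ² - x₂| ≤ c X^(-1/γ)`, `γ` being the golden ratio. -/
def IsExtremal (ξ : ℝ) : Prop :=
  Irrational ξ ∧ ¬ IsQuadraticIrrational ξ ∧
    ∃ c : ℝ, 0 < c ∧ ∀ X : ℝ, 1 ≤ X → ∃ x : Fin 3 → ℤ, x ≠ 0 ∧
      |(x 0 : ℝ)| ≤ X ∧
      |(x 0 : ℝ) * ξ - x 1| ≤ c * X ^ (-(1 / Real.goldenRatio)) ∧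
      |(x 0 : ℝ) * ξ ^ 2 - x 2| ≤ c * X ^ (-(1 / Real.goldenRatio))

/-- `x` is a nonzero integer solution of `|x₀| ≤ X`, `|x₁| ≤ X`,
`|x₀ ξ² + x₁ ξ + x₂| ≤ c X^(-γ²)`. -/
def IsDualSolution (ξ c X : ℝ) (x : Fin 3 → ℤ) : Prop :=
  x ≠ 0 ∧ |(x 0 : ℝ)| ≤ X ∧ |(x 1 : ℝ)| ≤ X ∧
    |(x 0 : ℝ) * ξ ^ 2 + (x 1 : ℝ) * ξ + x 2| ≤ c * X ^ (-(Real.goldenRatio ^ 2))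

/-- `f k ≪ g k ≪ f k` over the indices `k ≥ 1`. -/
def Comparable (f g : ℕ → ℝ) : Prop :=
  ∃ C : ℝ, 0 < C ∧ ∀ k : ℕ, 1 ≤ k → f k ≤ C * g k ∧ g k ≤ C * f k

/-- The determinant `x₀ x₂ - x₁²` of the symmetric matrix attached to a point. -/
def symDet (x : Fin 3 → ℤ) : ℤ := x 0 * x 2 - x 1 ^ 2

/-- The determinant of three integer points. -/
def det₃ (x y z : Fin 3 → ℤ) : ℤ := Matrix.det (Matrix.of ![x, y, z])

/-- Sequences `(Y_k)_{k ≥ 1}`, `(y_k)_{k ≥ 1}` of positive integers and integer points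
attached to `ξ`. The values at `k = 0` are irrelevant. The norm `‖y k‖` is
the maximum of the absolute values of the coordinates. -/
structure IsApproxSequence (ξ : ℝ) (Y : ℕ → ℕ) (y : ℕ → Fin 3 → ℤ) : Prop where
  pos : ∀ k, 1 ≤ k → 0 < Y k
  increasing : ∀ k, 1 ≤ k → Y k < Y (k + 1)
  growth : Comparable (fun k => (Y (k + 1) : ℝ)) (fun k => (Y k : ℝ) ^ Real.goldenRatio)
  norm_comparable : Comparable (fun k => ‖y k‖) (fun k => (Y k : ℝ))
  L_comparable : Comparable (fun k => L ξ (y k)) (fun k => (Y k : ℝ)⁻¹)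
  symDet_ne : ∀ k, 1 ≤ k → 1 ≤ |symDet (y k)|
  symDet_bounded : ∃ C : ℤ, ∀ k, 1 ≤ k → |symDet (y k)| ≤ C
  det_ne : ∀ k, 1 ≤ k → 1 ≤ |det₃ (y k) (y (k + 1)) (y (k + 2))|
  det_bounded : ∃ C : ℤ, ∀ k, 1 ≤ k → |det₃ (y k) (y (k + 1)) (y (k + 2))| ≤ C

/-- The integral polynomial `Q_k(T)`: the determinant of the matrix with rows
`(1, T, T²)`, `y_k`, `y_{k+1}`. -/
noncomputable def Q (y : ℕ → Fin 3 → ℤ) (k : ℕ) : Polynomial ℤ :=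
  Matrix.det (Matrix.of
    ![![1, Polynomial.X, Polynomial.X ^ 2],
      fun j => Polynomial.C (y k j),
      fun j => Polynomial.C (y (k + 1) j)])

end Roy

/-!
An integer point `x` close to the curve `(1, ξ, ξ²)` is studied through its height `|x 0|` and its
distance `L ξ x`. Take a sequence of minimal points `x i`, of heights `X i` and distances `L i`.
Extremality says `L i ≪ X (i + 1) ^ (-1/γ)`, and this exponent is just large enough for two
nonvanishing integers to determine everything.

* As `1/γ > 1/2`, the integer `symDet (x i)` is nonzero for large `i`
  (`le_sq_of_symDet_eq_zero`); it is `≪ X i * L i`, so `X (i + 1) ≪ X i ^ γ`.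
* As `ξ` is not algebraic of degree at most `2`, the determinant of three consecutive minimal points
  is nonzero infinitely often (`IsMinimalSequence.exists_det₃_ne_zero`); it is
  `≪ X (i + 2) * L (i + 1) * L i`, so `X (i + 1) ^ γ ≪ X (i + 2)` for such `i`.

Thus for the middle point of an independent triple `X (i + 2) ~ X (i + 1) ^ γ` and
`L (i + 1) ~ 1 / X (i + 1)` (`log_estimates`). The points `y k` are these middle points. Between
two consecutive independent triples all minimal points lie in one plane, of which any two consecutive
ones form a lattice basis (`IsMinimalSequence.exists_eq_add_of_det₃_eq_zero`). Comparing the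
exterior products at both ends shows that the next middle point has height `~ X (i + 1) ^ γ`
(`IsExtremalSequence.log_abs_consecutive`), and comparing the planes shows that three successive
middle points are independent (`IsExtremalSequence.det₃_consecutive_ne_zero`). Multiplicative
constants are handled by taking logarithms throughout this part.

For any such sequence, the coefficients of `Q y k` are minors of `y k` and `y (k + 1)`. Hence they
are `≪ Y k ^ (1/γ)`, while the value at `ξ` is `≪ 1 / (Y k * Y (k + 1)) ≪ Y k ^ (-γ²)`. Choosing `k`
with `Y k ^ (1/γ) ≪ X ≪ Y (k + 1) ^ (1/γ) ≪ Y k` gives the solutions for large `X`. If the leading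
coefficient vanished, the first coordinate of `y (k + 1)` would divide that of `y k` times the bounded
nonzero integer `symDet (y (k + 1))`, contrary to the growth of `Y`.
-/

namespace Roy

variable {ξ : ℝ}

/-! ### Estimates in terms of the distance to the curve -/

theorem abs_mul_sub_le_L (ξ : ℝ) (x : Fin 3 → ℤ) : |(x 0 : ℝ) * ξ - x 1| ≤ L ξ x :=
  le_max_left _ _

theorem abs_mul_sq_sub_le_L (ξ : ℝ) (x : Fin 3 → ℤ) : |(x 0 : ℝ) * ξ ^ 2 - x 2| ≤ L ξ x :=
  le_max_right _ _

theorem L_nonneg (ξ : ℝ) (x : Fin 3 → ℤ) : 0 ≤ L ξ x :=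
  (abs_nonneg _).trans (abs_mul_sub_le_L ξ x)

theorem L_pos (hξ : Irrational ξ) {x : Fin 3 → ℤ} (hx : x ≠ 0) : 0 < L ξ x := by
  refine lt_of_le_of_ne (L_nonneg ξ x) fun h => hx ?_
  have h1 : (x 0 : ℝ) * ξ - x 1 = 0 :=
    abs_eq_zero.1 (le_antisymm ((abs_mul_sub_le_L ξ x).trans h.symm.le) (abs_nonneg _))
  have h2 : (x 0 : ℝ) * ξ ^ 2 - x 2 = 0 :=
    abs_eq_zero.1 (le_antisymm ((abs_mul_sq_sub_le_L ξ x).trans h.symm.le) (abs_nonneg _))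
  have h0 : x 0 = 0 := by
    by_contra h0
    exact ((irrational_intCast_mul_iff.2 ⟨h0, hξ⟩).ne_int (x 1)) (sub_eq_zero.1 h1)
  simp only [h0, Int.cast_zero, zero_mul, zero_sub, neg_eq_zero, Int.cast_eq_zero] at h1 h2
  ext i
  fin_cases i <;> assumption

theorem det₃_eq (x y z : Fin 3 → ℤ) :
    det₃ x y z = x 0 * (y 1 * z 2 - y 2 * z 1) - x 1 * (y 0 * z 2 - y 2 * z 0)
      + x 2 * (y 0 * z 1 - y 1 * z 0) := by
  simp [det₃, Matrix.det_fin_three]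
  ring

theorem abs_minor_one_le (ξ : ℝ) (x y : Fin 3 → ℤ) :
    |(x 0 : ℝ) * y 1 - x 1 * y 0| ≤ |(x 0 : ℝ)| * L ξ y + |(y 0 : ℝ)| * L ξ x := by
  have h : (x 0 : ℝ) * y 1 - x 1 * y 0
      = y 0 * (x 0 * ξ - x 1) - x 0 * (y 0 * ξ - y 1) := by ring
  rw [h, add_comm]
  refine (abs_sub _ _).trans ?_
  rw [abs_mul, abs_mul]
  gcongr
  · exact abs_mul_sub_le_L ξ x
  · exact abs_mul_sub_le_L ξ y

theorem abs_minor_two_le (ξ : ℝ) (x y : Fin 3 → ℤ) :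
    |(x 0 : ℝ) * y 2 - x 2 * y 0| ≤ |(x 0 : ℝ)| * L ξ y + |(y 0 : ℝ)| * L ξ x := by
  have h : (x 0 : ℝ) * y 2 - x 2 * y 0
      = y 0 * (x 0 * ξ ^ 2 - x 2) - x 0 * (y 0 * ξ ^ 2 - y 2) := by ring
  rw [h, add_comm]
  refine (abs_sub _ _).trans ?_
  rw [abs_mul, abs_mul]
  gcongr
  · exact abs_mul_sq_sub_le_L ξ x
  · exact abs_mul_sq_sub_le_L ξ y

theorem abs_mul_L_le_of_minors {x y : Fin 3 → ℤ} {B : ℝ}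
    (h₁ : |(x 0 : ℝ) * y 1 - x 1 * y 0| ≤ B) (h₂ : |(x 0 : ℝ) * y 2 - x 2 * y 0| ≤ B) :
    |(y 0 : ℝ)| * L ξ x ≤ B + |(x 0 : ℝ)| * L ξ y := by
  rw [L, mul_max_of_nonneg _ _ (abs_nonneg _), ← abs_mul, ← abs_mul]
  apply max_le
  · have h : (y 0 : ℝ) * (x 0 * ξ - x 1)
        = (x 0 * y 1 - x 1 * y 0) + x 0 * (y 0 * ξ - y 1) := by ring
    rw [h]
    refine (abs_add_le _ _).trans ?_
    rw [abs_mul]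
    gcongr
    exact abs_mul_sub_le_L ξ y
  · have h : (y 0 : ℝ) * (x 0 * ξ ^ 2 - x 2)
        = (x 0 * y 2 - x 2 * y 0) + x 0 * (y 0 * ξ ^ 2 - y 2) := by ring
    rw [h]
    refine (abs_add_le _ _).trans ?_
    rw [abs_mul]
    gcongr
    exact abs_mul_sq_sub_le_L ξ y

/-- The expression bounded here is the determinant with rows `(1, ξ, ξ²)`, `x`, `y`. -/
theorem abs_det_moment_le (ξ : ℝ) (x y : Fin 3 → ℤ) :
    |((x 0 : ℝ) * y 1 - x 1 * y 0) * ξ ^ 2 - (x 0 * y 2 - x 2 * y 0) * ξ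
      + (x 1 * y 2 - x 2 * y 1)| ≤ 2 * (L ξ x * L ξ y) := by
  have h : ((x 0 : ℝ) * y 1 - x 1 * y 0) * ξ ^ 2 - (x 0 * y 2 - x 2 * y 0) * ξ
      + (x 1 * y 2 - x 2 * y 1) = (x 0 * ξ - x 1) * (y 0 * ξ ^ 2 - y 2)
        - (x 0 * ξ ^ 2 - x 2) * (y 0 * ξ - y 1) := by ring
  rw [h, two_mul]
  refine (abs_sub _ _).trans ?_
  rw [abs_mul, abs_mul]
  have := L_nonneg ξ x
  gcongr
  · exact abs_mul_sub_le_L ξ x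
  · exact abs_mul_sq_sub_le_L ξ y
  · exact abs_mul_sq_sub_le_L ξ x
  · exact abs_mul_sub_le_L ξ y

theorem abs_det₃_le (ξ : ℝ) (x y z : Fin 3 → ℤ) :
    |(det₃ x y z : ℝ)| ≤ 2 * (|(x 0 : ℝ)| * (L ξ y * L ξ z) + |(y 0 : ℝ)| * (L ξ x * L ξ z)
      + |(z 0 : ℝ)| * (L ξ x * L ξ y)) := by
  have key : ∀ u v w : Fin 3 → ℤ, |(u 0 : ℝ) * ((v 0 * ξ - v 1) * (w 0 * ξ ^ 2 - w 2)
      - (v 0 * ξ ^ 2 - v 2) * (w 0 * ξ - w 1))| ≤ |(u 0 : ℝ)| * (2 * (L ξ v * L ξ w)) := by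
    intro u v w
    rw [abs_mul]
    gcongr
    refine le_trans (le_of_eq ?_) (abs_det_moment_le ξ v w)
    congr 1
    ring
  have h : (det₃ x y z : ℝ)
      = x 0 * ((y 0 * ξ - y 1) * (z 0 * ξ ^ 2 - z 2) - (y 0 * ξ ^ 2 - y 2) * (z 0 * ξ - z 1))
      - y 0 * ((x 0 * ξ - x 1) * (z 0 * ξ ^ 2 - z 2) - (x 0 * ξ ^ 2 - x 2) * (z 0 * ξ - z 1))
      + z 0 * ((x 0 * ξ - x 1) * (y 0 * ξ ^ 2 - y 2)
        - (x 0 * ξ ^ 2 - x 2) * (y 0 * ξ - y 1)) := by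
    rw [det₃_eq]
    push_cast
    ring
  rw [h]
  refine (abs_add_le _ _).trans ?_
  have h1 := abs_sub ((x 0 : ℝ) * ((y 0 * ξ - y 1) * (z 0 * ξ ^ 2 - z 2)
      - (y 0 * ξ ^ 2 - y 2) * (z 0 * ξ - z 1)))
    (y 0 * ((x 0 * ξ - x 1) * (z 0 * ξ ^ 2 - z 2) - (x 0 * ξ ^ 2 - x 2) * (z 0 * ξ - z 1)))
  linarith [key x y z, key y x z, key z x y]

theorem abs_symDet_le (ξ : ℝ) (x : Fin 3 → ℤ) :
    |(symDet x : ℝ)| ≤ (1 + 2 * |ξ|) * (|(x 0 : ℝ)| * L ξ x) + L ξ x ^ 2 := by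
  have h : (symDet x : ℝ) = (2 * ξ * (x 0 * (x 0 * ξ - x 1)) - x 0 * (x 0 * ξ ^ 2 - x 2))
      - (x 0 * ξ - x 1) ^ 2 := by
    simp only [symDet]
    push_cast
    ring
  have h1 := abs_mul_sub_le_L ξ x
  have h2 := abs_mul_sq_sub_le_L ξ x
  rw [h]
  refine (abs_sub _ _).trans (add_le_add ((abs_sub _ _).trans ?_) ?_)
  · rw [abs_mul, abs_mul, abs_mul, abs_mul, abs_two]
    have : 2 * |ξ| * (|(x 0 : ℝ)| * |(x 0 : ℝ) * ξ - x 1|) ≤ 2 * |ξ| * (|(x 0 : ℝ)| * L ξ x) := by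
      gcongr
    have : |(x 0 : ℝ)| * |(x 0 : ℝ) * ξ ^ 2 - x 2| ≤ |(x 0 : ℝ)| * L ξ x := by gcongr
    linarith
  · rw [abs_pow]
    gcongr

theorem abs_apply_zero_le_norm (x : Fin 3 → ℤ) : |(x 0 : ℝ)| ≤ ‖x‖ := by
  simpa [Int.norm_eq_abs] using norm_le_pi_norm x 0

theorem norm_le_abs_add_L (ξ : ℝ) (x : Fin 3 → ℤ) :
    ‖x‖ ≤ (1 + |ξ| + ξ ^ 2) * |(x 0 : ℝ)| + L ξ x := by
  have hL := L_nonneg ξ x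
  have h1 := abs_mul_sub_le_L ξ x
  have h2 := abs_mul_sq_sub_le_L ξ x
  have ha := abs_nonneg (x 0 : ℝ)
  have hb : 0 ≤ |ξ| * |(x 0 : ℝ)| := by positivity
  have hc : 0 ≤ ξ ^ 2 * |(x 0 : ℝ)| := by positivity
  refine (pi_norm_le_iff_of_nonneg (by positivity)).2 fun i => ?_
  rw [Int.norm_eq_abs]
  fin_cases i
  · simp only [Fin.zero_eta]
    linarith
  · have h : (x 1 : ℝ) = ξ * x 0 - (x 0 * ξ - x 1) := by ring
    have := abs_sub (ξ * x 0) (x 0 * ξ - x 1 : ℝ)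
    rw [← h, abs_mul] at this
    simp only [Fin.mk_one]
    linarith
  · have h : (x 2 : ℝ) = ξ ^ 2 * x 0 - (x 0 * ξ ^ 2 - x 2) := by ring
    have := abs_sub (ξ ^ 2 * x 0) (x 0 * ξ ^ 2 - x 2 : ℝ)
    rw [← h, abs_mul, abs_of_nonneg (sq_nonneg ξ)] at this
    simp only [Fin.reduceFinMk]
    linarith

/-! ### Sequences of minimal points -/

/-- A sequence of minimal points of `ξ`: the heights `|x i 0|` increase, the values `L ξ (x i)`
decrease, and no nonzero integer point of height less than `|x (i + 1) 0|` does better than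
`x i`. The height of a point is the absolute value of its first coordinate, not its norm. -/
structure IsMinimalSequence (ξ : ℝ) (x : ℕ → Fin 3 → ℤ) : Prop where
  ne_zero : ∀ i, x i ≠ 0
  L_lt : ∀ i, L ξ (x (i + 1)) < L ξ (x i)
  abs_lt : ∀ i, |x i 0| < |x (i + 1) 0|
  L_le : ∀ i (z : Fin 3 → ℤ), z ≠ 0 → |z 0| < |x (i + 1) 0| → L ξ (x i) ≤ L ξ z

theorem exists_L_minimal (ξ : ℝ) (n : ℕ) :
    ∃ z : Fin 3 → ℤ, z ≠ 0 ∧ |z 0| ≤ n ∧ ∀ w : Fin 3 → ℤ, w ≠ 0 → |w 0| ≤ n → L ξ z ≤ L ξ w := by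
  set S : Set (Fin 3 → ℤ) := {w | w ≠ 0 ∧ |w 0| ≤ n ∧ L ξ w ≤ 1} with hS
  have hfin : S.Finite := by
    refine ((isCompact_closedBall (0 : Fin 3 → ℤ)
      ((1 + |ξ| + ξ ^ 2) * n + 1)).finite_of_discrete).subset fun w hw => ?_
    rw [mem_closedBall_zero_iff]
    refine (norm_le_abs_add_L ξ w).trans (add_le_add ?_ hw.2.2)
    have : |(w 0 : ℝ)| ≤ n := by exact_mod_cast hw.2.1
    gcongr
  have hne : S.Nonempty := by
    refine ⟨![0, 0, 1], fun h => ?_, by simp, by simp [L]⟩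
    simpa using congrFun h 2
  obtain ⟨z, hz, hmin⟩ := Set.exists_min_image S (L ξ) hfin hne
  refine ⟨z, hz.1, hz.2.1, fun w hw hwn => ?_⟩
  rcases le_or_gt (L ξ w) 1 with h | h
  · exact hmin w ⟨hw, hwn, h⟩
  · exact hz.2.2.trans h.le

theorem exists_next_minimal (h : ∀ ε : ℝ, 0 < ε → ∃ z : Fin 3 → ℤ, z ≠ 0 ∧ L ξ z < ε)
    (hξ : Irrational ξ) {x : Fin 3 → ℤ} (hx : x ≠ 0)
    (hmin : ∀ w : Fin 3 → ℤ, w ≠ 0 → |w 0| ≤ |x 0| → L ξ x ≤ L ξ w) :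
    ∃ y : Fin 3 → ℤ, (y ≠ 0 ∧ ∀ w : Fin 3 → ℤ, w ≠ 0 → |w 0| ≤ |y 0| → L ξ y ≤ L ξ w) ∧
      L ξ y < L ξ x ∧ |x 0| < |y 0| ∧
      ∀ z : Fin 3 → ℤ, z ≠ 0 → |z 0| < |y 0| → L ξ x ≤ L ξ z := by
  classical
  have hex : ∃ n : ℕ, ∃ z : Fin 3 → ℤ, z ≠ 0 ∧ |z 0| ≤ n ∧ L ξ z < L ξ x := by
    obtain ⟨z, hz, hzL⟩ := h _ (L_pos hξ hx)
    exact ⟨(z 0).natAbs, z, hz, by simp, hzL⟩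
  obtain ⟨z, hz, hzn, hzL⟩ := Nat.find_spec hex
  obtain ⟨y, hy, hyn, hymin⟩ := exists_L_minimal ξ (Nat.find hex)
  have hyx : L ξ y < L ξ x := (hymin z hz hzn).trans_lt hzL
  refine ⟨y, ⟨hy, fun w hw hwy => hymin w hw (hwy.trans hyn)⟩, hyx, ?_, fun w hw hwy => ?_⟩
  · by_contra hle
    exact absurd (hmin y hy (not_lt.1 hle)) (not_le.2 hyx)
  · by_contra hlt
    refine Nat.find_min hex (m := (w 0).natAbs) ?_ ⟨w, hw, by simp, not_le.1 hlt⟩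
    have hlt' := hwy.trans_le hyn
    rw [← Int.natCast_natAbs] at hlt'
    exact_mod_cast hlt'

theorem exists_isMinimalSequence
    (h : ∀ ε : ℝ, 0 < ε → ∃ z : Fin 3 → ℤ, z ≠ 0 ∧ L ξ z < ε) (hξ : Irrational ξ) :
    ∃ x : ℕ → Fin 3 → ℤ, IsMinimalSequence ξ x := by
  let M : Type := {x : Fin 3 → ℤ // x ≠ 0 ∧
    ∀ w : Fin 3 → ℤ, w ≠ 0 → |w 0| ≤ |x 0| → L ξ x ≤ L ξ w}
  obtain ⟨x₀, hx₀, hx₀n, hmin⟩ := exists_L_minimal ξ 0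
  let m₀ : M := ⟨x₀, hx₀, fun w hw hwx => hmin w hw (hwx.trans hx₀n)⟩
  have step : ∀ x : M, ∃ y : M, L ξ y.1 < L ξ x.1 ∧ |x.1 0| < |y.1 0| ∧
      ∀ z : Fin 3 → ℤ, z ≠ 0 → |z 0| < |y.1 0| → L ξ x.1 ≤ L ξ z := fun x => by
    obtain ⟨y, hy, hy'⟩ := exists_next_minimal h hξ x.2.1 x.2.2
    exact ⟨⟨y, hy⟩, hy'⟩
  choose next hnext using step
  let s : ℕ → M := fun n => Nat.rec m₀ (fun _ x => next x) n
  exact ⟨fun i => (s i).1, fun i => (s i).2.1, fun i => (hnext (s i)).1,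
    fun i => (hnext (s i)).2.1, fun i => (hnext (s i)).2.2⟩

namespace IsMinimalSequence

variable {x : ℕ → Fin 3 → ℤ}

theorem shift (h : IsMinimalSequence ξ x) (N : ℕ) : IsMinimalSequence ξ fun i => x (i + N) where
  ne_zero i := h.ne_zero _
  L_lt i := by simpa only [Nat.add_right_comm] using h.L_lt (i + N)
  abs_lt i := by simpa only [Nat.add_right_comm] using h.abs_lt (i + N)
  L_le i := by simpa only [Nat.add_right_comm] using h.L_le (i + N)

theorem strictMono_abs (h : IsMinimalSequence ξ x) : StrictMono fun i => |x i 0| :=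
  strictMono_nat_of_lt_succ h.abs_lt

theorem strictAnti_L (h : IsMinimalSequence ξ x) : StrictAnti fun i => L ξ (x i) :=
  strictAnti_nat_of_succ_lt h.L_lt

theorem le_abs (h : IsMinimalSequence ξ x) (i : ℕ) : (i : ℤ) ≤ |x i 0| := by
  induction i with
  | zero => simp
  | succ i ih =>
    have := h.abs_lt i
    push_cast
    omega

/-- Two distinct minimal points are linearly independent. -/
theorem eq_zero_of_smul_add_smul (h : IsMinimalSequence ξ x) (hξ : Irrational ξ) {i j : ℕ}
    (hij : i < j) {q r : ℤ} (hqr : ∀ a, q * x i a + r * x j a = 0) : q = 0 ∧ r = 0 := by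
  have hX : |(x i 0 : ℝ)| < |(x j 0 : ℝ)| := by exact_mod_cast h.strictMono_abs hij
  have hL : L ξ (x j) < L ξ (x i) := h.strictAnti_L hij
  have hLj := L_pos hξ (h.ne_zero j)
  have hqr' : ∀ a, (q : ℝ) * x i a = -(r * x j a) := fun a => by
    have := hqr a
    rw [eq_neg_iff_add_eq_zero]
    exact_mod_cast this
  -- Proportional points have proportional heights and proportional values of `L`.
  have e0 : |(q : ℝ)| * |(x i 0 : ℝ)| = |(r : ℝ)| * |(x j 0 : ℝ)| := by
    rw [← abs_mul, ← abs_mul, hqr', abs_neg]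
  have eL : |(q : ℝ)| * L ξ (x i) = |(r : ℝ)| * L ξ (x j) := by
    rw [L, L, mul_max_of_nonneg _ _ (abs_nonneg _), mul_max_of_nonneg _ _ (abs_nonneg _),
      ← abs_mul, ← abs_mul, ← abs_mul, ← abs_mul]
    congr 1
    · rw [← abs_neg]
      congr 1
      linear_combination (-ξ) * hqr' 0 + hqr' 1
    · rw [← abs_neg]
      congr 1
      linear_combination (-ξ ^ 2) * hqr' 0 + hqr' 2
  have hq0 := abs_nonneg (q : ℝ)
  have hr0 := abs_nonneg (r : ℝ)
  have hx0 := abs_nonneg (x i 0 : ℝ)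
  have hr : (r : ℝ) = 0 := by
    by_contra hr
    have hr1 := abs_pos.2 hr
    have hle : |(r : ℝ)| < |(q : ℝ)| := by
      by_contra hle
      nlinarith [mul_le_mul_of_nonneg_right (not_lt.1 hle) hx0, mul_lt_mul_of_pos_left hX hr1]
    nlinarith [mul_lt_mul_of_pos_right hle hLj, mul_lt_mul_of_pos_left hL (hr1.trans hle)]
  have hq : (q : ℝ) = 0 := by
    rw [hr, abs_zero, zero_mul] at eL
    exact abs_eq_zero.1 ((mul_eq_zero.1 eL).resolve_right (hLj.trans hL).ne')
  exact ⟨by exact_mod_cast hq, by exact_mod_cast hr⟩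

end IsMinimalSequence

/-- A vanishing determinant of three integer points is an integral linear relation. -/
theorem exists_relation_of_det₃_eq_zero {x y z : Fin 3 → ℤ} (h : det₃ x y z = 0) :
    ∃ p q r : ℤ, (p ≠ 0 ∨ q ≠ 0 ∨ r ≠ 0) ∧ ∀ a, p * x a + q * y a + r * z a = 0 := by
  obtain ⟨v, hv, hv'⟩ := Matrix.exists_vecMul_eq_zero_iff.2 h
  refine ⟨v 0, v 1, v 2, ?_, fun a => ?_⟩
  · by_contra hcon
    push Not at hcon
    refine hv ?_
    ext i
    fin_cases i
    exacts [hcon.1, hcon.2.1, hcon.2.2]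
  · have := congrFun hv' a
    simpa [Matrix.vecMul, dotProduct, Fin.sum_univ_three] using this

theorem abs_mul_add_mul_le_of_abs_le_half {s t a b A B : ℝ} (hs : |s| ≤ 1 / 2)
    (ht : |t| ≤ 1 / 2) (ha : |a| ≤ A) (hb : |b| ≤ B) : |s * a + t * b| ≤ (A + B) / 2 := by
  refine (abs_add_le _ _).trans ?_
  rw [abs_mul, abs_mul]
  have := mul_le_mul hs ha (abs_nonneg _) (by norm_num)
  have := mul_le_mul ht hb (abs_nonneg _) (by norm_num)
  linarith

namespace IsMinimalSequence

variable {x : ℕ → Fin 3 → ℤ}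

/-- Two consecutive minimal points form a basis of the lattice of all integer points of the plane
they span: an integer point of this plane can be reduced modulo the two points to one with
coordinates at most `1/2`, which contradicts minimality unless it is zero. -/
theorem exists_eq_add_of_det₃_eq_zero (h : IsMinimalSequence ξ x) (hξ : Irrational ξ) (i : ℕ)
    {z : Fin 3 → ℤ} (hz : det₃ z (x i) (x (i + 1)) = 0) :
    ∃ s t : ℤ, ∀ a, z a = s * x i a + t * x (i + 1) a := by
  obtain ⟨p, q, r, hne, hrel⟩ := exists_relation_of_det₃_eq_zero hz
  have hp : p ≠ 0 := by
    rintro rfl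
    obtain ⟨rfl, rfl⟩ := h.eq_zero_of_smul_add_smul hξ (Nat.lt_succ_self i) (q := q) (r := r)
      fun a => by simpa using hrel a
    simp at hne
  set s : ℝ := -q / p with hs
  set t : ℝ := -r / p with ht
  have hpR : (p : ℝ) ≠ 0 := by exact_mod_cast hp
  have hzR : ∀ a, (z a : ℝ) = s * x i a + t * x (i + 1) a := fun a => by
    have : (p : ℝ) * z a + q * x i a + r * x (i + 1) a = 0 := by exact_mod_cast hrel a
    rw [hs, ht]
    field_simp
    linear_combination this
  refine ⟨round s, round t, ?_⟩
  set w : Fin 3 → ℤ := fun a => z a - (round s * x i a + round t * x (i + 1) a) with hw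
  suffices hw0 : w = 0 by
    intro a
    have := congrFun hw0 a
    simpa [hw, sub_eq_zero] using this
  have hwR : ∀ a, (w a : ℝ) = (s - round s) * x i a + (t - round t) * x (i + 1) a := fun a => by
    simp only [hw]
    push_cast
    rw [hzR]
    ring
  have hs' := abs_sub_round s
  have ht' := abs_sub_round t
  have hX : |(x i 0 : ℝ)| < |(x (i + 1) 0 : ℝ)| := by exact_mod_cast h.abs_lt i
  have hL := h.L_lt i
  by_contra hw0
  have h0 : |w 0| < |x (i + 1) 0| := by
    have := abs_mul_add_mul_le_of_abs_le_half hs' ht' le_rfl le_rfl (a := (x i 0 : ℝ))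
      (b := (x (i + 1) 0 : ℝ))
    rw [← hwR] at this
    have : |(w 0 : ℝ)| < |(x (i + 1) 0 : ℝ)| := by linarith
    exact_mod_cast this
  have h1 : L ξ w ≤ (L ξ (x i) + L ξ (x (i + 1))) / 2 := by
    apply max_le
    · have e : (w 0 : ℝ) * ξ - w 1 = (s - round s) * (x i 0 * ξ - x i 1)
          + (t - round t) * (x (i + 1) 0 * ξ - x (i + 1) 1) := by rw [hwR, hwR]; ring
      rw [e]
      exact abs_mul_add_mul_le_of_abs_le_half hs' ht' (abs_mul_sub_le_L _ _) (abs_mul_sub_le_L _ _)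
    · have e : (w 0 : ℝ) * ξ ^ 2 - w 2 = (s - round s) * (x i 0 * ξ ^ 2 - x i 2)
          + (t - round t) * (x (i + 1) 0 * ξ ^ 2 - x (i + 1) 2) := by rw [hwR, hwR]; ring
      rw [e]
      exact abs_mul_add_mul_le_of_abs_le_half hs' ht' (abs_mul_sq_sub_le_L _ _)
        (abs_mul_sq_sub_le_L _ _)
  linarith [h.L_le i w hw0 h0]

/-- As long as consecutive triples of minimal points remain dependent, the lattices generated by
consecutive pairs increase. -/
theorem exists_eq_add_of_forall_det₃_eq_zero (h : IsMinimalSequence ξ x) (hξ : Irrational ξ)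
    {i j : ℕ} (hij : i ≤ j) (hdet : ∀ m, i ≤ m → m < j → det₃ (x m) (x (m + 1)) (x (m + 2)) = 0) :
    (∃ s t : ℤ, ∀ a, x i a = s * x j a + t * x (j + 1) a) ∧
      ∃ s t : ℤ, ∀ a, x (i + 1) a = s * x j a + t * x (j + 1) a := by
  induction j, hij using Nat.le_induction with
  | base => exact ⟨⟨1, 0, by simp⟩, ⟨0, 1, by simp⟩⟩
  | succ j hij ih =>
    obtain ⟨⟨s, t, hst⟩, ⟨s', t', hst'⟩⟩ := ih fun m hm hmj => hdet m hm (hmj.trans j.lt_succ_self)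
    obtain ⟨u, v, huv⟩ := h.exists_eq_add_of_det₃_eq_zero hξ (j + 1) (hdet j hij j.lt_succ_self)
    refine ⟨⟨s * u + t, s * v, fun a => ?_⟩, ⟨s' * u + t', s' * v, fun a => ?_⟩⟩
    · rw [hst, huv]; ring
    · rw [hst', huv]; ring

/-- If all minimal points from some index on lay in one plane, the plane would contain
`(1, ξ, ξ ^ 2)`, and `ξ` would be a root of an integral polynomial of degree at most `2`. -/
theorem exists_det₃_ne_zero (h : IsMinimalSequence ξ x) (hξ : Irrational ξ)
    (hquad : ¬ IsQuadraticIrrational ξ) (N : ℕ) :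
    ∃ i, N ≤ i ∧ det₃ (x i) (x (i + 1)) (x (i + 2)) ≠ 0 := by
  by_contra! hcon
  set y := x N
  set z := x (N + 1)
  have hplane : ∀ m, N ≤ m → det₃ y z (x m) = 0 ∧ det₃ y z (x (m + 1)) = 0 := by
    intro m hm
    induction m, hm using Nat.le_induction with
    | base => constructor <;> (rw [det₃_eq]; ring)
    | succ m hm ih =>
      refine ⟨ih.2, ?_⟩
      obtain ⟨p, q, r, hne, hrel⟩ := exists_relation_of_det₃_eq_zero (hcon m hm)
      have hr : r ≠ 0 := by
        rintro rfl
        obtain ⟨rfl, rfl⟩ := h.eq_zero_of_smul_add_smul hξ m.lt_succ_self (q := p) (r := q)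
          fun a => by simpa using hrel a
        simp at hne
      have : r * det₃ y z (x (m + 2)) = 0 := by
        have h1 := ih.1
        have h2 := ih.2
        rw [det₃_eq] at h1 h2 ⊢
        linear_combination (y 1 * z 2 - y 2 * z 1) * hrel 0 - (y 0 * z 2 - y 2 * z 0) * hrel 1
          + (y 0 * z 1 - y 1 * z 0) * hrel 2 - p * h1 - q * h2
      exact (mul_eq_zero.1 this).resolve_left hr
  -- The normal vector `(A, B, C)` of the plane.
  set A := y 1 * z 2 - y 2 * z 1 with hA
  set B := -(y 0 * z 2 - y 2 * z 0) with hB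
  set C := y 0 * z 1 - y 1 * z 0 with hC
  have hvan : (A : ℝ) + B * ξ + C * ξ ^ 2 = 0 := by
    by_contra hv
    have hv' := abs_pos.2 hv
    set D : ℝ := |(B : ℝ)| * L ξ (x 0) + |(C : ℝ)| * L ξ (x 0) with hD
    obtain ⟨n, hn⟩ := exists_nat_gt (D / |(A : ℝ) + B * ξ + C * ξ ^ 2|)
    set m := max N n
    have hm : (n : ℝ) ≤ |(x m 0 : ℝ)| := by
      have h1 : (n : ℤ) ≤ |x m 0| := le_trans (by simp [m]) (h.le_abs m)
      exact_mod_cast h1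
    have hlin : (x m 0 : ℝ) * A + x m 1 * B + x m 2 * C = 0 := by
      have := (hplane m (le_max_left _ _)).1
      rw [det₃_eq] at this
      have h2 : x m 0 * A + x m 1 * B + x m 2 * C = 0 := by
        rw [hA, hB, hC]; linear_combination this
      exact_mod_cast h2
    have hLm : L ξ (x m) ≤ L ξ (x 0) := h.strictAnti_L.antitone (Nat.zero_le m)
    have e : (x m 0 : ℝ) * (A + B * ξ + C * ξ ^ 2)
        = B * (x m 0 * ξ - x m 1) + C * (x m 0 * ξ ^ 2 - x m 2) := by
      linear_combination hlin
    have hle : |(x m 0 : ℝ)| * |(A : ℝ) + B * ξ + C * ξ ^ 2| ≤ D := by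
      rw [← abs_mul, e]
      refine (abs_add_le _ _).trans ?_
      rw [abs_mul, abs_mul, hD]
      gcongr
      · exact (abs_mul_sub_le_L _ _).trans hLm
      · exact (abs_mul_sq_sub_le_L _ _).trans hLm
    rw [div_lt_iff₀ hv'] at hn
    nlinarith [mul_le_mul_of_nonneg_right hm hv'.le]
  have hC0 : C = 0 := by
    by_contra hC0
    refine hquad ⟨hξ, Polynomial.C C * Polynomial.X ^ 2 + Polynomial.C B * Polynomial.X
      + Polynomial.C A, Polynomial.natDegree_quadratic hC0, ?_⟩
    simp
    linear_combination hvan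
  have hB0 : B = 0 := by
    by_contra hB0
    have h1 : (B : ℝ) * ξ = ((-A : ℤ) : ℝ) := by
      rw [hC0] at hvan
      push_cast at hvan ⊢
      linear_combination hvan
    exact (irrational_intCast_mul_iff.2 ⟨hB0, hξ⟩).ne_int _ h1
  have hrel := h.eq_zero_of_smul_add_smul hξ N.lt_succ_self (q := z 0) (r := -y 0) fun a => by
    change z 0 * y a + -y 0 * z a = 0
    fin_cases a
    · simp; ring
    · simp only [Fin.mk_one]; linear_combination -hC0
    · simp only [Fin.reduceFinMk]; linear_combination hB0
  have := h.abs_lt N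
  change |y 0| < |z 0| at this
  rw [hrel.1, neg_eq_zero.1 hrel.2] at this
  exact lt_irrefl _ this

end IsMinimalSequence

/-- If a point `x` satisfies `x₀ x₂ = x₁²`, then `x₀` divides the squares of the integers
`x₀ y₁ - x₁ y₀` and `x₀ y₂ - x₁ y₁`. When both are small, they vanish, and `y` is
proportional to `x`. -/
theorem proportional_of_symDet_eq_zero {x y : Fin 3 → ℤ} (hx : symDet x = 0) (hx0 : x 0 ≠ 0)
    (h₁ : (x 0 * y 1 - x 1 * y 0) ^ 2 < |x 0|) (h₂ : (x 0 * y 2 - x 1 * y 1) ^ 2 < |x 0|) (a) :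
    x 0 * y a = y 0 * x a := by
  rw [symDet] at hx
  have d1 : x 0 ∣ (x 0 * y 1 - x 1 * y 0) ^ 2 :=
    ⟨x 0 * y 1 ^ 2 - 2 * x 1 * y 0 * y 1 + x 2 * y 0 ^ 2, by linear_combination -y 0 ^ 2 * hx⟩
  have d2 : x 0 ∣ (x 0 * y 2 - x 1 * y 1) ^ 2 :=
    ⟨x 0 * y 2 ^ 2 - 2 * x 1 * y 1 * y 2 + x 2 * y 1 ^ 2, by linear_combination -y 1 ^ 2 * hx⟩
  have e1 := pow_eq_zero_iff two_ne_zero |>.1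
    (Int.eq_zero_of_abs_lt_dvd ((abs_dvd _ _).2 d1) (by rwa [abs_of_nonneg (sq_nonneg _)]))
  have e2 := pow_eq_zero_iff two_ne_zero |>.1
    (Int.eq_zero_of_abs_lt_dvd ((abs_dvd _ _).2 d2) (by rwa [abs_of_nonneg (sq_nonneg _)]))
  fin_cases a
  · simp; ring
  · simp only [Fin.mk_one]; linear_combination e1
  · simp only [Fin.reduceFinMk]
    apply mul_left_cancel₀ hx0
    linear_combination x 0 * e2 + x 1 * e1 - y 0 * hx

/-! ### Minimal points of an extremal number -/

theorem one_div_goldenRatio : 1 / Real.goldenRatio = Real.goldenRatio - 1 := by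
  rw [div_eq_iff Real.goldenRatio_pos.ne']
  linear_combination -Real.goldenRatio_sq

theorem eight_fifths_lt_goldenRatio : 8 / 5 < Real.goldenRatio := by
  have h1 := Real.goldenRatio_sq
  have h2 := Real.one_lt_goldenRatio
  nlinarith

theorem IsExtremal.exists_L_lt (h : IsExtremal ξ) (ε : ℝ) (hε : 0 < ε) :
    ∃ z : Fin 3 → ℤ, z ≠ 0 ∧ L ξ z < ε := by
  obtain ⟨-, -, c, hc, hsol⟩ := h
  have hlim := (tendsto_rpow_neg_atTop (y := 1 / Real.goldenRatio)
    (one_div_pos.2 Real.goldenRatio_pos)).const_mul c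
  rw [mul_zero] at hlim
  obtain ⟨X, hX, hX1⟩ := ((hlim.eventually (gt_mem_nhds hε)).and
    (Filter.eventually_ge_atTop 1)).exists
  obtain ⟨z, hz, -, h1, h2⟩ := hsol X hX1
  exact ⟨z, hz, (max_le h1 h2).trans_lt hX⟩

/-- For a sequence of minimal points, the extremality condition at `X = |x (i + 1) 0| / 2`
bounds `L ξ (x i)`. -/
theorem IsExtremal.exists_log_L_le (h : IsExtremal ξ) {x : ℕ → Fin 3 → ℤ}
    (hx : IsMinimalSequence ξ x) :
    ∃ K : ℝ, ∀ i, 1 ≤ i → Real.log (L ξ (x i))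
      ≤ K - (Real.goldenRatio - 1) * Real.log |(x (i + 1) 0 : ℝ)| := by
  obtain ⟨hirr, -, c, hc, hsol⟩ := h
  refine ⟨Real.log c + (Real.goldenRatio - 1) * Real.log 2, fun i hi => ?_⟩
  have hX2 : (2 : ℝ) ≤ |(x (i + 1) 0 : ℝ)| := by
    have := hx.le_abs (i + 1)
    have h2 : (2 : ℤ) ≤ |x (i + 1) 0| := by push_cast at this; omega
    exact_mod_cast h2
  set X := |(x (i + 1) 0 : ℝ)| with hX
  obtain ⟨z, hz, hz0, h1, h2⟩ := hsol (X / 2) (by linarith)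
  have hlt : |z 0| < |x (i + 1) 0| := by
    have : |(z 0 : ℝ)| < |(x (i + 1) 0 : ℝ)| := by linarith
    exact_mod_cast this
  have hle : L ξ (x i) ≤ c * (X / 2) ^ (-(1 / Real.goldenRatio)) :=
    (hx.L_le i z hz hlt).trans (max_le h1 h2)
  have hlog := Real.log_le_log (L_pos hirr (hx.ne_zero i)) hle
  rw [Real.log_mul hc.ne' (by positivity), Real.log_rpow (by positivity),
    Real.log_div (by positivity) (by norm_num), one_div_goldenRatio] at hlog
  linarith

/-- A minimal point `y` preceding a point `x` with `symDet x = 0` is at distance at least about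
`|x 0| ^ (-1/2)` from the curve, as otherwise it would be proportional to `x`. -/
theorem le_sq_of_symDet_eq_zero {x y : Fin 3 → ℤ} (hx : symDet x = 0)
    (hne : ∃ a, x 0 * y a ≠ y 0 * x a) (hx1 : 1 ≤ |(x 0 : ℝ)|)
    (hL1 : L ξ x ≤ 1) (hyx : |(y 0 : ℝ)| ≤ |(x 0 : ℝ)|) (hL : L ξ x ≤ L ξ y) :
    |(x 0 : ℝ)| ≤ ((2 + 2 * |ξ|) * (|(x 0 : ℝ)| * L ξ y)) ^ 2 := by
  by_contra! hlt
  have hξ0 := abs_nonneg ξ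
  have hLx := L_nonneg ξ x
  have hLy := L_nonneg ξ y
  have hXL : 0 ≤ |(x 0 : ℝ)| * L ξ y := by positivity
  have hYL : |(y 0 : ℝ)| * L ξ x ≤ |(x 0 : ℝ)| * L ξ y := by gcongr
  have hLXL : L ξ y ≤ |(x 0 : ℝ)| * L ξ y := le_mul_of_one_le_left hLy hx1
  have h₁ : |(x 0 : ℝ) * y 1 - x 1 * y 0| ≤ (2 + 2 * |ξ|) * (|(x 0 : ℝ)| * L ξ y) := by
    have := abs_minor_one_le ξ x y
    nlinarith [mul_nonneg hξ0 hXL]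
  have h₂ : |(x 0 : ℝ) * y 2 - x 1 * y 1| ≤ (2 + 2 * |ξ|) * (|(x 0 : ℝ)| * L ξ y) := by
    have e : (x 0 : ℝ) * y 2 - x 1 * y 1 = -(x 0 * (y 0 * ξ ^ 2 - y 2))
        + ξ * (x 0 * (y 0 * ξ - y 1)) + ξ * (y 0 * (x 0 * ξ - x 1))
        - (x 0 * ξ - x 1) * (y 0 * ξ - y 1) := by ring
    have t1 : |-((x 0 : ℝ) * (y 0 * ξ ^ 2 - y 2))| ≤ |(x 0 : ℝ)| * L ξ y := by
      rw [abs_neg, abs_mul]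
      gcongr
      exact abs_mul_sq_sub_le_L ξ y
    have t2 : |ξ * ((x 0 : ℝ) * (y 0 * ξ - y 1))| ≤ |ξ| * (|(x 0 : ℝ)| * L ξ y) := by
      rw [abs_mul, abs_mul]
      gcongr
      exact abs_mul_sub_le_L ξ y
    have t3 : |ξ * ((y 0 : ℝ) * (x 0 * ξ - x 1))| ≤ |ξ| * (|(x 0 : ℝ)| * L ξ y) := by
      refine le_trans ?_ (mul_le_mul_of_nonneg_left hYL hξ0)
      rw [abs_mul, abs_mul]
      gcongr
      exact abs_mul_sub_le_L ξ x
    have t4 : |((x 0 : ℝ) * ξ - x 1) * (y 0 * ξ - y 1)| ≤ |(x 0 : ℝ)| * L ξ y := by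
      refine le_trans ?_ hLXL
      rw [abs_mul, ← one_mul (L ξ y)]
      gcongr
      · exact (abs_mul_sub_le_L ξ x).trans hL1
      · exact abs_mul_sub_le_L ξ y
    rw [e]
    refine (abs_sub _ _).trans ?_
    have := abs_add_three (-((x 0 : ℝ) * (y 0 * ξ ^ 2 - y 2)))
      (ξ * (x 0 * (y 0 * ξ - y 1))) (ξ * (y 0 * (x 0 * ξ - x 1)))
    linarith
  have hx0 : x 0 ≠ 0 := by
    rintro h0
    simp [h0] at hx1
    linarith
  obtain ⟨a, ha⟩ := hne
  refine ha (proportional_of_symDet_eq_zero hx hx0 ?_ ?_ a)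
  · have : ((x 0 : ℝ) * y 1 - x 1 * y 0) ^ 2 < |(x 0 : ℝ)| := by
      rw [← sq_abs]
      exact (pow_le_pow_left₀ (abs_nonneg _) h₁ 2).trans_lt hlt
    exact_mod_cast this
  · have : ((x 0 : ℝ) * y 2 - x 1 * y 1) ^ 2 < |(x 0 : ℝ)| := by
      rw [← sq_abs]
      exact (pow_le_pow_left₀ (abs_nonneg _) h₂ 2).trans_lt hlt
    exact_mod_cast this

/-- A tail of a sequence of minimal points of an extremal number, on which all the estimates that
hold for large indices hold with one constant `K`, on a logarithmic scale. -/
structure IsExtremalSequence (ξ K : ℝ) (x : ℕ → Fin 3 → ℤ) : Prop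
    extends IsMinimalSequence ξ x where
  irrational : Irrational ξ
  one_le_abs : ∀ i, 1 ≤ |(x i 0 : ℝ)|
  L_le_one : ∀ i, L ξ (x i) ≤ 1
  symDet_ne : ∀ i, symDet (x i) ≠ 0
  log_six_le : Real.log 6 ≤ K
  log_le : Real.log (2 + 2 * |ξ|) ≤ K
  log_L_le : ∀ i, Real.log (L ξ (x i))
    ≤ K - (Real.goldenRatio - 1) * Real.log |(x (i + 1) 0 : ℝ)|
  le_log_abs : ∀ i, 3 * (16 * K + 1) ≤ Real.log |(x i 0 : ℝ)|

theorem IsExtremal.exists_isExtremalSequence (h : IsExtremal ξ) :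
    ∃ (K : ℝ) (x : ℕ → Fin 3 → ℤ), IsExtremalSequence ξ K x := by
  have hirr := h.1
  obtain ⟨x, hx⟩ := exists_isMinimalSequence h.exists_L_lt h.1
  obtain ⟨K₀, hK₀⟩ := h.exists_log_L_le hx
  set K := max (max (Real.log 6) (Real.log (2 + 2 * |ξ|))) K₀ with hK
  have hK1 : Real.log 6 ≤ K := (le_max_left _ _).trans (le_max_left _ _)
  have hK2 : Real.log (2 + 2 * |ξ|) ≤ K := (le_max_right _ _).trans (le_max_left _ _)
  have hE : ∀ i, 1 ≤ i → Real.log (L ξ (x i))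
      ≤ K - (Real.goldenRatio - 1) * Real.log |(x (i + 1) 0 : ℝ)| := fun i hi =>
    (hK₀ i hi).trans (sub_le_sub_right (le_max_right _ _) _)
  have hKpos : 0 < K := (Real.log_pos (by norm_num)).trans_le hK1
  have hg := eight_fifths_lt_goldenRatio
  obtain ⟨N, hN⟩ := exists_nat_gt (Real.exp (3 * (16 * K + 1)))
  have hN1 : (1 : ℝ) ≤ N := (Real.one_le_exp (by positivity)).trans hN.le
  have hN1' : 1 ≤ N := by exact_mod_cast hN1
  have habs : ∀ i, N ≤ i → Real.exp (3 * (16 * K + 1)) ≤ |(x i 0 : ℝ)| := fun i hi => by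
    have h1 : (N : ℤ) ≤ |x i 0| := (Int.ofNat_le.2 hi).trans (hx.le_abs i)
    have h2 : (N : ℝ) ≤ |(x i 0 : ℝ)| := by exact_mod_cast h1
    exact hN.le.trans h2
  have hone : ∀ i, N ≤ i → 1 ≤ |(x i 0 : ℝ)| := fun i hi =>
    (Real.one_le_exp (by positivity)).trans (habs i hi)
  have hlog : ∀ i, N ≤ i → 3 * (16 * K + 1) ≤ Real.log |(x i 0 : ℝ)| := fun i hi =>
    (Real.le_log_iff_exp_le (by linarith [hone i hi])).2 (habs i hi)
  have hL1 : ∀ i, N ≤ i → L ξ (x i) ≤ 1 := fun i hi => by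
    rw [← Real.log_nonpos_iff (L_nonneg _ _)]
    have h1 := hE i (hN1'.trans hi)
    have h2 := hlog (i + 1) (hi.trans i.le_succ)
    nlinarith
  have hsym : ∀ i, N ≤ i → symDet (x (i + 1)) ≠ 0 := fun i hi h0 => by
    have hne : ∃ a, x (i + 1) 0 * x i a ≠ x i 0 * x (i + 1) a := by
      by_contra! hcon
      have := hx.eq_zero_of_smul_add_smul h.1 i.lt_succ_self (q := x (i + 1) 0) (r := -x i 0)
        fun a => by linear_combination hcon a
      have h1 := hone (i + 1) (hi.trans i.le_succ)
      rw [this.1] at h1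
      simp at h1
      linarith
    have hi1 := hone (i + 1) (hi.trans i.le_succ)
    have hle := le_sq_of_symDet_eq_zero (ξ := ξ) h0 hne hi1
      (hL1 (i + 1) (hi.trans i.le_succ)) (by exact_mod_cast (hx.abs_lt i).le) (hx.L_lt i).le
    have hLpos := L_pos h.1 (hx.ne_zero i)
    have hlg := Real.log_le_log (by linarith) hle
    rw [Real.log_pow, Real.log_mul (by positivity) (by positivity),
      Real.log_mul (by positivity) (by positivity)] at hlg
    have h1 := hE i (hN1'.trans hi)
    have h2 := hlog (i + 1) (hi.trans i.le_succ)
    push_cast at hlg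
    nlinarith
  refine ⟨K, fun i => x (i + (N + 1)), ?_⟩
  have hge : ∀ i, N ≤ i + (N + 1) := fun i => by omega
  exact
    { toIsMinimalSequence := hx.shift (N + 1)
      irrational := h.1
      one_le_abs := fun i => hone _ (hge i)
      L_le_one := fun i => hL1 _ (hge i)
      symDet_ne := fun i => hsym (i + N) (by omega)
      log_six_le := hK1
      log_le := hK2
      log_L_le := fun i => by
        have := hE (i + (N + 1)) (by omega)
        rwa [Nat.add_right_comm] at this
      le_log_abs := fun i => hlog _ (hge i) }

/-! ### The sequence of middle points of independent triples -/

/-- The logarithmic estimates at a triple `x i, x (i + 1), x (i + 2)` of independent minimal points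
of an extremal number: `α`, `β` stand for the logarithms of the last two heights, `l`, `m` for those
of the first two values of `L`. The exponents are forced because `γ² = γ + 1`. -/
theorem log_estimates {K α β l m : ℝ}
    (hl : l ≤ K - (Real.goldenRatio - 1) * α) (hm : m ≤ K - (Real.goldenRatio - 1) * β)
    (hsym : 0 ≤ K + α + m) (hdet : 0 ≤ K + β + m + l) (hK : 0 ≤ K) :
    β ≤ Real.goldenRatio * α + 4 * K ∧ Real.goldenRatio * α ≤ β + 9 * K ∧
      m ≤ 10 * K - α ∧ -(Real.goldenRatio - 1) * α - 6 * K ≤ l := by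
  have hsq := Real.goldenRatio_sq
  have h1 := eight_fifths_lt_goldenRatio
  have h2 := Real.goldenRatio_lt_two
  set g := Real.goldenRatio
  have hβ : β ≤ g * α + 4 * K := by
    have := mul_le_mul_of_nonneg_left (a := g) (show (g - 1) * β ≤ 2 * K + α by linarith)
      (by linarith)
    have e : g * ((g - 1) * β) = β := by linear_combination β * hsq
    nlinarith
  have hα : g * α ≤ β + 9 * K := by
    have := mul_le_mul_of_nonneg_left (a := g + 1)
      (show (g - 1) * α ≤ 3 * K + (2 - g) * β by linarith) (by linarith)
    have e1 : (g + 1) * ((g - 1) * α) = g * α := by linear_combination α * hsq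
    have e2 : (g + 1) * (3 * K + (2 - g) * β) = 3 * K * (g + 1) + β := by
      linear_combination -β * hsq
    nlinarith
  refine ⟨hβ, hα, ?_, ?_⟩
  · have := mul_le_mul_of_nonneg_left (a := g - 1) hα (by linarith)
    have e : (g - 1) * (g * α) = α := by linear_combination α * hsq
    nlinarith
  · have := mul_le_mul_of_nonneg_left (a := 2 - g) hβ (by linarith)
    have e : (2 - g) * (g * α) = (g - 1) * α := by linear_combination -α * hsq
    nlinarith

theorem comparable_of_log {f g : ℕ → ℝ} (C : ℝ) (hf : ∀ k, 0 < f k) (hg : ∀ k, 0 < g k)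
    (h₁ : ∀ k, Real.log (f k) ≤ Real.log (g k) + C)
    (h₂ : ∀ k, Real.log (g k) ≤ Real.log (f k) + C) : Comparable f g := by
  have key : ∀ a b : ℝ, 0 < a → 0 < b → Real.log a ≤ Real.log b + C → a ≤ Real.exp C * b := by
    intro a b ha hb hab
    rw [← Real.log_le_log_iff ha (by positivity), Real.log_mul (by positivity) hb.ne',
      Real.log_exp]
    linarith
  exact ⟨Real.exp C, Real.exp_pos C, fun k _ =>
    ⟨key _ _ (hf k) (hg k) (h₁ k), key _ _ (hg k) (hf k) (h₂ k)⟩⟩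

theorem exists_int_bound {f : ℕ → ℤ} (B : ℝ) (h : ∀ k, |(f k : ℝ)| ≤ B) :
    ∃ C : ℤ, ∀ k, 1 ≤ k → |f k| ≤ C :=
  ⟨⌈B⌉, fun k _ => by
    have : ((|f k| : ℤ) : ℝ) ≤ (⌈B⌉ : ℝ) := by
      push_cast
      exact (h k).trans (Int.le_ceil B)
    exact_mod_cast this⟩

namespace IsExtremalSequence

variable {K : ℝ} {x : ℕ → Fin 3 → ℤ}

theorem L_apply_pos (h : IsExtremalSequence ξ K x) (i : ℕ) : 0 < L ξ (x i) :=
  L_pos h.irrational (h.ne_zero i)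

theorem abs_pos (h : IsExtremalSequence ξ K x) (i : ℕ) : 0 < |(x i 0 : ℝ)| :=
  zero_lt_one.trans_le (h.one_le_abs i)

theorem K_pos (h : IsExtremalSequence ξ K x) : 0 < K :=
  (Real.log_pos (by norm_num)).trans_le h.log_six_le

theorem abs_le (h : IsExtremalSequence ξ K x) {i j : ℕ} (hij : i ≤ j) :
    |(x i 0 : ℝ)| ≤ |(x j 0 : ℝ)| := by
  exact_mod_cast h.strictMono_abs.monotone hij

theorem L_le_L (h : IsExtremalSequence ξ K x) {i j : ℕ} (hij : i ≤ j) :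
    L ξ (x j) ≤ L ξ (x i) := h.strictAnti_L.antitone hij

theorem abs_symDet_le (h : IsExtremalSequence ξ K x) (i : ℕ) :
    |(symDet (x i) : ℝ)| ≤ (2 + 2 * |ξ|) * (|(x i 0 : ℝ)| * L ξ (x i)) := by
  have h1 := Roy.abs_symDet_le ξ (x i)
  have h2 := h.L_le_one i
  have h3 := h.one_le_abs i
  have h4 := h.L_apply_pos i
  nlinarith

theorem log_abs_add_log_L_nonneg (h : IsExtremalSequence ξ K x) (i : ℕ) :
    0 ≤ K + Real.log |(x i 0 : ℝ)| + Real.log (L ξ (x i)) := by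
  have h1 : (1 : ℝ) ≤ |(symDet (x i) : ℝ)| := by
    exact_mod_cast Int.one_le_abs (h.symDet_ne i)
  have h2 := Real.log_nonneg (h1.trans (h.abs_symDet_le i))
  have := h.abs_pos i
  have := h.L_apply_pos i
  rw [Real.log_mul (by positivity) (by positivity), Real.log_mul (by positivity) (by positivity)]
    at h2
  linarith [h.log_le]

theorem abs_det₃_le (h : IsExtremalSequence ξ K x) {i j m : ℕ} (hij : i ≤ j) (hjm : j ≤ m) :
    |(det₃ (x i) (x j) (x m) : ℝ)| ≤ 6 * (|(x m 0 : ℝ)| * (L ξ (x i) * L ξ (x j))) := by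
  have hi := (h.L_apply_pos i).le
  have hj := (h.L_apply_pos j).le
  have hm := (h.L_apply_pos m).le
  have t1 : |(x i 0 : ℝ)| * (L ξ (x j) * L ξ (x m)) ≤ |(x m 0 : ℝ)| * (L ξ (x i) * L ξ (x j)) := by
    rw [mul_comm (L ξ (x i))]
    exact mul_le_mul (h.abs_le (hij.trans hjm))
      (mul_le_mul_of_nonneg_left (h.L_le_L (hij.trans hjm)) hj) (by positivity) (abs_nonneg _)
  have t2 : |(x j 0 : ℝ)| * (L ξ (x i) * L ξ (x m)) ≤ |(x m 0 : ℝ)| * (L ξ (x i) * L ξ (x j)) := by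
    exact mul_le_mul (h.abs_le hjm) (mul_le_mul_of_nonneg_left (h.L_le_L hjm) hi)
      (by positivity) (abs_nonneg _)
  linarith [Roy.abs_det₃_le ξ (x i) (x j) (x m)]

theorem log_estimates_of_det₃_ne_zero (h : IsExtremalSequence ξ K x) {i : ℕ}
    (hi : det₃ (x i) (x (i + 1)) (x (i + 2)) ≠ 0) :
    Real.log |(x (i + 2) 0 : ℝ)| ≤ Real.goldenRatio * Real.log |(x (i + 1) 0 : ℝ)| + 4 * K ∧
      Real.goldenRatio * Real.log |(x (i + 1) 0 : ℝ)| ≤ Real.log |(x (i + 2) 0 : ℝ)| + 9 * K ∧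
      Real.log (L ξ (x (i + 1))) ≤ 10 * K - Real.log |(x (i + 1) 0 : ℝ)| ∧
      -(Real.goldenRatio - 1) * Real.log |(x (i + 1) 0 : ℝ)| - 6 * K ≤ Real.log (L ξ (x i)) := by
  refine log_estimates (h.log_L_le i) (h.log_L_le (i + 1)) (h.log_abs_add_log_L_nonneg (i + 1))
    ?_ h.K_pos.le
  have h1 : (1 : ℝ) ≤ |(det₃ (x i) (x (i + 1)) (x (i + 2)) : ℝ)| := by
    exact_mod_cast Int.one_le_abs hi
  have h2 := Real.log_nonneg (h1.trans (h.abs_det₃_le i.le_succ (i + 1).le_succ))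
  have := h.abs_pos (i + 2)
  have := h.L_apply_pos i
  have := h.L_apply_pos (i + 1)
  rw [Real.log_mul (by positivity) (by positivity), Real.log_mul (by positivity) (by positivity),
    Real.log_mul (by positivity) (by positivity)] at h2
  linarith [h.log_six_le]

/-- If `i < j` are consecutive indices of independent triples, then the plane spanned by
`x (i + 1)` and `x (i + 2)` is that spanned by `x j` and `x (j + 1)`. The latter two points form a
lattice basis, so their exterior product divides that of the former two. -/
theorem abs_mul_L_le (h : IsExtremalSequence ξ K x) {i j : ℕ} (hij : i < j)
    (hj : det₃ (x j) (x (j + 1)) (x (j + 2)) ≠ 0)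
    (hdet : ∀ m, i < m → m < j → det₃ (x m) (x (m + 1)) (x (m + 2)) = 0) :
    |(x (j + 1) 0 : ℝ)| * L ξ (x j) ≤ 4 * (|(x (i + 2) 0 : ℝ)| * L ξ (x (i + 1))) := by
  obtain ⟨⟨s, t, hst⟩, ⟨s', t', hst'⟩⟩ := h.exists_eq_add_of_forall_det₃_eq_zero h.irrational
    (i := i + 1) hij hdet
  have hd : s * t' - s' * t ≠ 0 := by
    intro h0
    have h1 := h.eq_zero_of_smul_add_smul h.irrational (Nat.lt_succ_self (i + 1)) (q := s')
      (r := -s) fun a => by rw [hst, hst']; linear_combination (-x (j + 1) a) * h0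
    have h2 := h.eq_zero_of_smul_add_smul h.irrational (Nat.lt_succ_self (i + 1)) (q := t')
      (r := -t) fun a => by rw [hst, hst']; linear_combination (x j a) * h0
    refine h.ne_zero (i + 1) (funext fun a => ?_)
    rw [hst, neg_eq_zero.1 h1.2, neg_eq_zero.1 h2.2]
    simp
  have hd1 : (1 : ℝ) ≤ |((s * t' - s' * t : ℤ) : ℝ)| := by exact_mod_cast Int.one_le_abs hd
  have hB : |(x (i + 1) 0 : ℝ)| * L ξ (x (i + 2)) + |(x (i + 2) 0 : ℝ)| * L ξ (x (i + 1))
      ≤ 2 * (|(x (i + 2) 0 : ℝ)| * L ξ (x (i + 1))) := by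
    have := mul_le_mul (h.abs_le (i + 1).le_succ) (h.L_le_L (i + 1).le_succ) (h.L_apply_pos _).le
      (h.abs_pos (i + 1 + 1)).le
    linarith
  have hmin : ∀ a b : Fin 3, |(x j a : ℝ) * x (j + 1) b - x j b * x (j + 1) a|
      ≤ |(x (i + 1) a : ℝ) * x (i + 2) b - x (i + 1) b * x (i + 2) a| := fun a b => by
    have e : (x (i + 1) a : ℝ) * x (i + 2) b - x (i + 1) b * x (i + 2) a
        = ((s * t' - s' * t : ℤ) : ℝ) * (x j a * x (j + 1) b - x j b * x (j + 1) a) := by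
      rw [hst a, hst b, hst' a, hst' b]
      push_cast
      ring
    rw [e, abs_mul]
    exact le_mul_of_one_le_left (abs_nonneg _) hd1
  have hmain := abs_mul_L_le_of_minors (ξ := ξ)
    (((hmin 0 1).trans (abs_minor_one_le ξ _ _)).trans hB)
    (((hmin 0 2).trans (by
      rw [mul_comm (x (i + 1) 2 : ℝ)]
      simpa [mul_comm] using abs_minor_two_le ξ (x (i + 1)) (x (i + 2)))).trans hB)
  -- The term `|x j 0| * L ξ (x (j + 1))` is bounded while `|x (j + 1) 0| * L ξ (x j)` is large.
  have hsmall : 2 * (|(x j 0 : ℝ)| * L ξ (x (j + 1))) ≤ |(x (j + 1) 0 : ℝ)| * L ξ (x j) := by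
    have p1 := h.abs_pos j
    have p2 := h.abs_pos (j + 1)
    have p3 := h.L_apply_pos j
    have p4 := h.L_apply_pos (j + 1)
    rw [← Real.log_le_log_iff (by positivity) (by positivity),
      Real.log_mul (by positivity) (by positivity), Real.log_mul (by positivity) (by positivity),
      Real.log_mul (by positivity) (by positivity)]
    obtain ⟨-, -, e3, e4⟩ := h.log_estimates_of_det₃_ne_zero hj
    have e5 := Real.log_le_log p1 (h.abs_le j.le_succ)
    have e6 := h.le_log_abs (j + 1)
    have e7 : Real.log 2 ≤ 1 := by linarith [Real.log_two_lt_d9]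
    have hsq := Real.goldenRatio_sq
    have hg1 := eight_fifths_lt_goldenRatio
    have hg2 := Real.goldenRatio_lt_two
    have hK := h.K_pos
    have e8 : 16 * K + 1 ≤ (2 - Real.goldenRatio) * Real.log |(x (j + 1) 0 : ℝ)| := by
      have : 1 / 3 ≤ 2 - Real.goldenRatio := by nlinarith
      nlinarith
    simp only [Nat.succ_eq_add_one] at e5
    linarith
  linarith

/-- Along the indices of independent triples, each height is about the `γ`-th power of the
previous one. -/
theorem log_abs_consecutive (h : IsExtremalSequence ξ K x) {i j : ℕ} (hij : i < j)
    (hi : det₃ (x i) (x (i + 1)) (x (i + 2)) ≠ 0)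
    (hj : det₃ (x j) (x (j + 1)) (x (j + 2)) ≠ 0)
    (hdet : ∀ m, i < m → m < j → det₃ (x m) (x (m + 1)) (x (m + 2)) = 0) :
    Real.log |(x (j + 1) 0 : ℝ)|
        ≤ Real.goldenRatio * Real.log |(x (i + 1) 0 : ℝ)| + 63 * K ∧
      Real.goldenRatio * Real.log |(x (i + 1) 0 : ℝ)|
        ≤ Real.log |(x (j + 1) 0 : ℝ)| + 63 * K := by
  have hK := h.K_pos
  obtain ⟨a1, a2, a3, a4⟩ := h.log_estimates_of_det₃_ne_zero hi
  obtain ⟨b1, b2, b3, b4⟩ := h.log_estimates_of_det₃_ne_zero hj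
  constructor
  · have hW := h.abs_mul_L_le hij hj hdet
    have p1 := h.abs_pos (i + 2)
    have p2 := h.abs_pos (j + 1)
    have p3 := h.L_apply_pos j
    have p4 := h.L_apply_pos (i + 1)
    have hlog := Real.log_le_log (by positivity) hW
    rw [Real.log_mul (by positivity) (by positivity), Real.log_mul (by positivity) (by positivity),
      Real.log_mul (by positivity) (by positivity)] at hlog
    have h4 : Real.log 4 ≤ K := (Real.log_le_log (by norm_num) (by norm_num)).trans h.log_six_le
    have hsq := Real.goldenRatio_sq
    have hg1 := eight_fifths_lt_goldenRatio
    have hg2 := Real.goldenRatio_lt_two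
    set g := Real.goldenRatio
    set α := Real.log |(x (i + 1) 0 : ℝ)|
    set α' := Real.log |(x (j + 1) 0 : ℝ)|
    have h5 : (2 - g) * α' ≤ (g - 1) * α + 21 * K := by linarith
    have h6 := mul_le_mul_of_nonneg_left (a := g + 1) h5 (by linarith)
    have e1 : (g + 1) * ((2 - g) * α') = α' := by linear_combination -α' * hsq
    have e2 : (g + 1) * ((g - 1) * α + 21 * K) = g * α + 21 * K * (g + 1) := by
      linear_combination α * hsq
    nlinarith
  · have := Real.log_le_log (h.abs_pos (i + 2)) (h.abs_le (i := i + 2) (j := j + 1) (by omega))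
    linarith

/-- The determinant of the middle points of three consecutive independent triples does not
vanish. -/
theorem det₃_consecutive_ne_zero (h : IsExtremalSequence ξ K x) {i j m : ℕ} (hij : i < j)
    (hjm : j < m) (hj : det₃ (x j) (x (j + 1)) (x (j + 2)) ≠ 0)
    (hdet : ∀ n, i < n → n < j → det₃ (x n) (x (n + 1)) (x (n + 2)) = 0)
    (hdet' : ∀ n, j < n → n < m → det₃ (x n) (x (n + 1)) (x (n + 2)) = 0) :
    det₃ (x (i + 1)) (x (j + 1)) (x (m + 1)) ≠ 0 := by
  obtain ⟨⟨s, t, hst⟩, -⟩ := h.exists_eq_add_of_forall_det₃_eq_zero h.irrational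
    (i := i + 1) hij hdet
  obtain ⟨⟨p, q, hpq⟩, ⟨p', q', hpq'⟩⟩ := h.exists_eq_add_of_forall_det₃_eq_zero h.irrational
    (i := j + 1) hjm hdet'
  have hs : s ≠ 0 := by
    rintro rfl
    have := h.eq_zero_of_smul_add_smul h.irrational (i := i + 1) (j := j + 1) (by omega) (q := 1)
      (r := -t) fun a => by rw [hst]; ring
    exact one_ne_zero this.1
  have hp : p ≠ 0 := by
    rintro rfl
    have := h.eq_zero_of_smul_add_smul h.irrational (i := j + 1) (j := m + 1) (by omega) (q := 1)
      (r := -q) fun a => by rw [hpq]; ring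
    exact one_ne_zero this.1
  intro h0
  have key : p * s * det₃ (x j) (x (j + 1)) (x (j + 2))
      = (p * q' - p' * q) * det₃ (x (i + 1)) (x (j + 1)) (x (m + 1)) := by
    have e : ∀ a, p * x (j + 2) a = p' * x (j + 1) a + (p * q' - p' * q) * x (m + 1) a :=
      fun a => by rw [hpq, hpq']; ring
    simp only [det₃_eq, hst]
    linear_combination s * (x j 1 * x (j + 1) 2 - x j 2 * x (j + 1) 1) * e 0
      - s * (x j 0 * x (j + 1) 2 - x j 2 * x (j + 1) 0) * e 1
      + s * (x j 0 * x (j + 1) 1 - x j 1 * x (j + 1) 0) * e 2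
  rw [h0, mul_zero] at key
  exact mul_ne_zero (mul_ne_zero hp hs) hj key

theorem exists_isApproxSequence (h : IsExtremalSequence ξ K x)
    (hquad : ¬ IsQuadraticIrrational ξ) :
    ∃ (Y : ℕ → ℕ) (y : ℕ → Fin 3 → ℤ), IsApproxSequence ξ Y y := by
  classical
  set P : ℕ → Prop := fun i => det₃ (x i) (x (i + 1)) (x (i + 2)) ≠ 0 with hP
  have hinf : {i | P i}.Infinite := Set.infinite_of_forall_exists_gt fun n => by
    obtain ⟨i, hi, hi'⟩ := h.exists_det₃_ne_zero h.irrational hquad (n + 1)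
    exact ⟨i, hi', hi⟩
  set φ := Nat.nth P with hφ
  have hmono : StrictMono φ := Nat.nth_strictMono hinf
  have hmem : ∀ k, P (φ k) := Nat.nth_mem_of_infinite hinf
  have hgap : ∀ k m, φ k < m → m < φ (k + 1) → det₃ (x m) (x (m + 1)) (x (m + 2)) = 0 := by
    intro k m hkm hmk
    by_contra hm
    have e : φ (Nat.count P m) = m := Nat.nth_count (p := P) hm
    rw [← e, hmono.lt_iff_lt] at hkm hmk
    omega
  have hlt : ∀ k, φ k < φ (k + 1) := fun k => hmono k.lt_succ_self
  have hcast : ∀ k, (((x (φ k + 1) 0).natAbs : ℕ) : ℝ) = |(x (φ k + 1) 0 : ℝ)| := fun k => by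
    rw [Nat.cast_natAbs, Int.cast_abs]
  have hK := h.K_pos
  have hX := fun k => h.abs_pos (φ k + 1)
  have hL := fun k => h.L_apply_pos (φ k + 1)
  have hest := fun k => h.log_estimates_of_det₃_ne_zero (hmem k)
  have hcons := fun k => h.log_abs_consecutive (hlt k) (hmem k) (hmem (k + 1)) (hgap k)
  refine ⟨fun k => (x (φ k + 1) 0).natAbs, fun k => x (φ k + 1), ?_⟩
  refine
    { pos := fun k _ => ?_
      increasing := fun k _ => ?_
      growth := ?_
      norm_comparable := ?_
      L_comparable := ?_
      symDet_ne := fun k _ => Int.one_le_abs (h.symDet_ne _)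
      symDet_bounded := ?_
      det_ne := fun k _ => Int.one_le_abs (h.det₃_consecutive_ne_zero (hlt k) (hlt (k + 1))
        (hmem (k + 1)) (hgap k) (hgap (k + 1)))
      det_bounded := ?_ }
  · have := hX k
    rw [← hcast] at this
    exact_mod_cast this
  · have := h.strictMono_abs (Nat.succ_lt_succ (hlt k))
    simp only [Nat.succ_eq_add_one] at this
    rw [← Int.natCast_natAbs, ← Int.natCast_natAbs] at this
    exact_mod_cast this
  · simp only [hcast]
    refine comparable_of_log (63 * K) (fun k => hX (k + 1))
      (fun k => Real.rpow_pos_of_pos (hX k) _) (fun k => ?_) (fun k => ?_)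
    · rw [Real.log_rpow (hX k)]
      exact (hcons k).1
    · rw [Real.log_rpow (hX k)]
      exact (hcons k).2
  · simp only [hcast]
    refine ⟨2 + |ξ| + ξ ^ 2, by positivity, fun k _ => ⟨?_, ?_⟩⟩
    · have h1 := norm_le_abs_add_L ξ (x (φ k + 1))
      have h2 := h.L_le_one (φ k + 1)
      have h3 := h.one_le_abs (φ k + 1)
      linarith
    · refine (abs_apply_zero_le_norm _).trans (le_mul_of_one_le_left (norm_nonneg _) ?_)
      have := abs_nonneg ξ
      have := sq_nonneg ξ
      linarith
  · simp only [hcast]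
    refine comparable_of_log (10 * K) hL (fun k => inv_pos.2 (hX k)) (fun k => ?_) (fun k => ?_)
    · rw [Real.log_inv]
      linarith [(hest k).2.2.1]
    · rw [Real.log_inv]
      linarith [h.log_abs_add_log_L_nonneg (φ k + 1)]
  · refine exists_int_bound ((2 + 2 * |ξ|) * Real.exp (10 * K)) fun k => ?_
    refine (h.abs_symDet_le _).trans ?_
    gcongr
    have hXk := hX k
    have hLk := hL k
    rw [← Real.log_le_iff_le_exp (by positivity), Real.log_mul (by positivity) (by positivity)]
    linarith [(hest k).2.2.1]
  · refine exists_int_bound (6 * Real.exp (146 * K)) fun k => ?_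
    refine (h.abs_det₃_le (Nat.succ_le_succ (hlt k).le)
      (Nat.succ_le_succ (hlt (k + 1)).le)).trans ?_
    have h0 := hX (k + 2)
    have h1 := hL k
    have h2 := hL (k + 1)
    simp only [Nat.succ_eq_add_one, add_assoc, Nat.reduceAdd] at h0 h1 h2 ⊢
    gcongr
    rw [← Real.log_le_iff_le_exp (by positivity), Real.log_mul (by positivity) (by positivity),
      Real.log_mul (by positivity) (by positivity)]
    have e1 := (hest k).2.2.1
    have e2 := (hest (k + 1)).2.2.1
    have e3 := (hcons k).1
    have e4 := (hcons (k + 1)).1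
    have hsq := Real.goldenRatio_sq
    have hg1 := eight_fifths_lt_goldenRatio
    have hg2 := Real.goldenRatio_lt_two
    simp only [add_assoc, Nat.reduceAdd] at e4
    -- `Y (k + 2) / (Y (k + 1) * Y k)` is bounded because `γ * γ - γ - 1 = 0`.
    have e5 := mul_le_mul_of_nonneg_left (a := Real.goldenRatio - 1) e3 (by linarith)
    have e6 : (Real.goldenRatio - 1) * (Real.goldenRatio * Real.log |(x (φ k + 1) 0 : ℝ)| + 63 * K)
        = Real.log |(x (φ k + 1) 0 : ℝ)| + 63 * K * (Real.goldenRatio - 1) := by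
      linear_combination Real.log |(x (φ k + 1) 0 : ℝ)| * hsq
    nlinarith

end IsExtremalSequence

/-! ### The quadratic polynomials -/

theorem Q_eq (y : ℕ → Fin 3 → ℤ) (k : ℕ) :
    Q y k = Polynomial.C (y k 0 * y (k + 1) 1 - y k 1 * y (k + 1) 0) * Polynomial.X ^ 2
      + Polynomial.C (-(y k 0 * y (k + 1) 2 - y k 2 * y (k + 1) 0)) * Polynomial.X
      + Polynomial.C (y k 1 * y (k + 1) 2 - y k 2 * y (k + 1) 1) := by
  simp [Q, Matrix.det_fin_three]
  ring

theorem Q_coeff_two (y : ℕ → Fin 3 → ℤ) (k : ℕ) :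
    (Q y k).coeff 2 = y k 0 * y (k + 1) 1 - y k 1 * y (k + 1) 0 := by
  rw [Q_eq]
  simp only [Polynomial.coeff_add, Polynomial.coeff_C_mul, Polynomial.coeff_X_pow,
    Polynomial.coeff_X, Polynomial.coeff_C]
  norm_num

theorem Q_coeff_one (y : ℕ → Fin 3 → ℤ) (k : ℕ) :
    (Q y k).coeff 1 = -(y k 0 * y (k + 1) 2 - y k 2 * y (k + 1) 0) := by
  rw [Q_eq]
  simp only [Polynomial.coeff_add, Polynomial.coeff_C_mul, Polynomial.coeff_X_pow,
    Polynomial.coeff_X, Polynomial.coeff_C]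
  norm_num

theorem Q_coeff_zero (y : ℕ → Fin 3 → ℤ) (k : ℕ) :
    (Q y k).coeff 0 = y k 1 * y (k + 1) 2 - y k 2 * y (k + 1) 1 := by
  rw [Q_eq]
  simp only [Polynomial.coeff_add, Polynomial.coeff_C_mul, Polynomial.coeff_X_pow,
    Polynomial.coeff_X, Polynomial.coeff_C]
  norm_num

theorem natDegree_Q {y : ℕ → Fin 3 → ℤ} {k : ℕ}
    (h : y k 0 * y (k + 1) 1 - y k 1 * y (k + 1) 0 ≠ 0) : (Q y k).natDegree = 2 := by
  rw [Q_eq]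
  exact Polynomial.natDegree_quadratic h

/-- If `(y₀, y₁)` and `(z₀, z₁)` are proportional, then `z₀` divides `y₀ (z₀ z₂ - z₁²)`. -/
theorem abs_le_mul_abs_symDet {y z : Fin 3 → ℤ} (h : y 0 * z 1 - y 1 * z 0 = 0) (hy : y 0 ≠ 0)
    (hz : symDet z ≠ 0) : |z 0| ≤ |y 0| * |symDet z| := by
  have hdvd : z 0 ∣ y 0 * symDet z :=
    ⟨y 0 * z 2 - y 1 * z 1, by rw [symDet]; linear_combination (-z 1) * h⟩
  rw [← abs_mul]
  exact Int.le_of_dvd (abs_pos.2 (mul_ne_zero hy hz)) ((abs_dvd_abs _ _).2 hdvd)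

/-- The part of `IsApproxSequence` that the study of the polynomials `Q y k`
uses, with one constant `C`. -/
structure IsApproxSequenceWith (ξ C : ℝ) (Y : ℕ → ℕ) (y : ℕ → Fin 3 → ℤ) : Prop where
  one_le : 1 ≤ C
  one_le_cast : ∀ k, 1 ≤ k → (1 : ℝ) ≤ Y k
  le_succ : ∀ k, 1 ≤ k → (Y k : ℝ) ≤ Y (k + 1)
  succ_le_rpow : ∀ k, 1 ≤ k → (Y (k + 1) : ℝ) ≤ C * (Y k : ℝ) ^ Real.goldenRatio
  rpow_le_succ : ∀ k, 1 ≤ k → (Y k : ℝ) ^ Real.goldenRatio ≤ C * Y (k + 1)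
  norm_le : ∀ k, 1 ≤ k → ‖y k‖ ≤ C * Y k
  le_norm : ∀ k, 1 ≤ k → (Y k : ℝ) ≤ C * ‖y k‖
  L_le : ∀ k, 1 ≤ k → L ξ (y k) ≤ C * (Y k : ℝ)⁻¹
  symDet_ne : ∀ k, 1 ≤ k → symDet (y k) ≠ 0
  symDet_le : ∀ k, 1 ≤ k → |(symDet (y k) : ℝ)| ≤ C

theorem IsApproxSequence.exists_isApproxSequenceWith {Y : ℕ → ℕ} {y : ℕ → Fin 3 → ℤ}
    (h : IsApproxSequence ξ Y y) : ∃ C, IsApproxSequenceWith ξ C Y y := by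
  obtain ⟨C₁, -, h₁⟩ := h.growth
  obtain ⟨C₂, -, h₂⟩ := h.norm_comparable
  obtain ⟨C₃, -, h₃⟩ := h.L_comparable
  obtain ⟨C₄, h₄⟩ := h.symDet_bounded
  set C := max (max (max C₁ C₂) (max C₃ C₄)) 1 with hC
  have c1 : C₁ ≤ C := ((le_max_left _ _).trans (le_max_left _ _)).trans (le_max_left _ _)
  have c2 : C₂ ≤ C := ((le_max_right _ _).trans (le_max_left _ _)).trans (le_max_left _ _)
  have c3 : C₃ ≤ C := ((le_max_left _ _).trans (le_max_right _ _)).trans (le_max_left _ _)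
  have c4 : (C₄ : ℝ) ≤ C := ((le_max_right _ _).trans (le_max_right _ _)).trans (le_max_left _ _)
  refine ⟨C, ?_⟩
  exact
    { one_le := le_max_right _ _
      one_le_cast := fun k hk => by exact_mod_cast h.pos k hk
      le_succ := fun k hk => by exact_mod_cast (h.increasing k hk).le
      succ_le_rpow := fun k hk => (h₁ k hk).1.trans (by gcongr)
      rpow_le_succ := fun k hk => (h₁ k hk).2.trans (by gcongr)
      norm_le := fun k hk => (h₂ k hk).1.trans (by gcongr)
      le_norm := fun k hk => (h₂ k hk).2.trans (by gcongr)
      L_le := fun k hk => (h₃ k hk).1.trans (by gcongr)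
      symDet_ne := fun k hk h0 => by simpa [h0] using h.symDet_ne k hk
      symDet_le := fun k hk => by
        have : (|(symDet (y k) : ℝ)|) ≤ C₄ := by exact_mod_cast h₄ k hk
        exact this.trans c4 }

theorem IsApproxSequence.le_apply {Y : ℕ → ℕ} {y : ℕ → Fin 3 → ℤ} (h : IsApproxSequence ξ Y y)
    {k : ℕ} (hk : 1 ≤ k) : k ≤ Y k := by
  induction k, hk using Nat.le_induction with
  | base => exact h.pos 1 le_rfl
  | succ k hk ih => exact ih.trans_lt (h.increasing k hk)

namespace IsApproxSequenceWith

variable {C : ℝ} {Y : ℕ → ℕ} {y : ℕ → Fin 3 → ℤ}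

theorem minor_bound_le (h : IsApproxSequenceWith ξ C Y y) {k : ℕ} (hk : 1 ≤ k) :
    |(y k 0 : ℝ)| * L ξ (y (k + 1)) + |(y (k + 1) 0 : ℝ)| * L ξ (y k)
      ≤ 2 * C ^ 3 * (Y k : ℝ) ^ (Real.goldenRatio - 1) := by
  have hC := h.one_le
  have hY := h.one_le_cast k hk
  have hY' := h.le_succ k hk
  have hYpos : (0 : ℝ) < Y k := by linarith
  have hYpos' : (0 : ℝ) < Y (k + 1) := by linarith
  have t1 : |(y k 0 : ℝ)| * L ξ (y (k + 1)) ≤ (C * Y k) * (C * (Y (k + 1) : ℝ)⁻¹) :=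
    mul_le_mul ((abs_apply_zero_le_norm _).trans (h.norm_le k hk)) (h.L_le _ (by omega))
      (L_nonneg _ _) (by positivity)
  have t2 : |(y (k + 1) 0 : ℝ)| * L ξ (y k) ≤ (C * Y (k + 1)) * (C * (Y k : ℝ)⁻¹) :=
    mul_le_mul ((abs_apply_zero_le_norm _).trans (h.norm_le _ (by omega))) (h.L_le k hk)
      (L_nonneg _ _) (by positivity)
  have t3 : (C * Y k) * (C * (Y (k + 1) : ℝ)⁻¹) ≤ (C * Y (k + 1)) * (C * (Y k : ℝ)⁻¹) := by
    gcongr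
  have t4 : (C * Y (k + 1)) * (C * (Y k : ℝ)⁻¹) ≤ C ^ 3 * (Y k : ℝ) ^ (Real.goldenRatio - 1) := by
    rw [Real.rpow_sub_one hYpos.ne', div_eq_mul_inv]
    calc (C * Y (k + 1)) * (C * (Y k : ℝ)⁻¹)
        ≤ (C * (C * (Y k : ℝ) ^ Real.goldenRatio)) * (C * (Y k : ℝ)⁻¹) := by
          gcongr
          exact h.succ_le_rpow k hk
      _ = C ^ 3 * ((Y k : ℝ) ^ Real.goldenRatio * (Y k : ℝ)⁻¹) := by ring
  linarith

theorem L_mul_L_le (h : IsApproxSequenceWith ξ C Y y) {k : ℕ} (hk : 1 ≤ k) :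
    2 * (L ξ (y k) * L ξ (y (k + 1))) ≤ 2 * C ^ 3 * (Y k : ℝ) ^ (-(Real.goldenRatio ^ 2)) := by
  have hC := h.one_le
  have hY := h.one_le_cast k hk
  have hY' := h.le_succ k hk
  have hYpos : (0 : ℝ) < Y k := by linarith
  have hYpos' : (0 : ℝ) < Y (k + 1) := by linarith
  have hr := Real.rpow_pos_of_pos hYpos Real.goldenRatio
  have hinv : (Y (k + 1) : ℝ)⁻¹ ≤ C * ((Y k : ℝ) ^ Real.goldenRatio)⁻¹ := by
    have := h.rpow_le_succ k hk
    rw [← div_eq_mul_inv, le_div_iff₀ hr, inv_mul_le_iff₀ hYpos']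
    linarith
  have e : (Y k : ℝ) ^ (-(Real.goldenRatio ^ 2))
      = (Y k : ℝ)⁻¹ * ((Y k : ℝ) ^ Real.goldenRatio)⁻¹ := by
    rw [Real.goldenRatio_sq, Real.rpow_neg hYpos.le, Real.rpow_add_one hYpos.ne', mul_inv, mul_comm]
  rw [e]
  calc 2 * (L ξ (y k) * L ξ (y (k + 1)))
      ≤ 2 * ((C * (Y k : ℝ)⁻¹) * (C * (C * ((Y k : ℝ) ^ Real.goldenRatio)⁻¹))) := by
        have := L_nonneg ξ (y k)
        have := L_nonneg ξ (y (k + 1))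
        gcongr
        · exact h.L_le k hk
        · exact (h.L_le _ (by omega)).trans (by gcongr)
    _ = _ := by ring

theorem L_le_const (h : IsApproxSequenceWith ξ C Y y) {k : ℕ} (hk : 1 ≤ k) : L ξ (y k) ≤ C :=
  (h.L_le k hk).trans
    (mul_le_of_le_one_right (by linarith [h.one_le]) (inv_le_one_of_one_le₀ (h.one_le_cast k hk)))

/-- `Q y k` has degree `2` for large `k`: otherwise the first coordinate of `y (k + 1)` would be
bounded by a multiple of that of `y k`, against the growth of `Y`. -/
theorem leadingCoeff_ne_zero (h : IsApproxSequenceWith ξ C Y y) {k : ℕ} (hk : 1 ≤ k)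
    (hlarge : (2 + |ξ| + ξ ^ 2) * C ^ 4 < (Y k : ℝ) ^ (Real.goldenRatio - 1)) :
    y k 0 * y (k + 1) 1 - y k 1 * y (k + 1) 0 ≠ 0 := by
  intro h0
  have hC := h.one_le
  have hY := h.one_le_cast k hk
  have hYpos : (0 : ℝ) < Y k := by linarith
  set A := 1 + |ξ| + ξ ^ 2 with hA
  have hA1 : 1 ≤ A := by
    have := abs_nonneg ξ
    have := sq_nonneg ξ
    linarith
  have hle : (Y k : ℝ) ^ (Real.goldenRatio - 1) ≤ Y k := by
    conv_rhs => rw [← Real.rpow_one (Y k : ℝ)]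
    exact Real.rpow_le_rpow_of_exponent_le hY (by linarith [Real.goldenRatio_lt_two])
  have hlarge' : (A + 1) * C ^ 4 < (Y k : ℝ) ^ (Real.goldenRatio - 1) := by
    convert hlarge using 2
    ring
  have hy0 : y k 0 ≠ 0 := by
    intro hy0
    have h1 := norm_le_abs_add_L ξ (y k)
    rw [hy0, Int.cast_zero, abs_zero, mul_zero, zero_add] at h1
    have h2 : (Y k : ℝ) ≤ C * C :=
      (h.le_norm k hk).trans (by gcongr; exact h1.trans (h.L_le_const hk))
    have h3 : C * C ≤ C ^ 4 := by
      rw [← sq]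
      exact pow_le_pow_right₀ hC (by norm_num)
    nlinarith [show 0 < C ^ 4 by positivity]
  have hz0 : |(y (k + 1) 0 : ℝ)| ≤ |(y k 0 : ℝ)| * C := by
    have h1 : |(y (k + 1) 0 : ℝ)| ≤ |(y k 0 : ℝ)| * |(symDet (y (k + 1)) : ℝ)| := by
      exact_mod_cast abs_le_mul_abs_symDet h0 hy0 (h.symDet_ne _ (by omega))
    exact h1.trans (by gcongr; exact h.symDet_le _ (by omega))
  have hstep : (Y (k + 1) : ℝ) ≤ (A + 1) * C ^ 3 * Y k := by
    calc (Y (k + 1) : ℝ) ≤ C * ‖y (k + 1)‖ := h.le_norm _ (by omega)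
      _ ≤ C * (A * ((C * Y k) * C) + C) := by
        gcongr
        refine (norm_le_abs_add_L ξ _).trans (add_le_add ?_ (h.L_le_const (by omega)))
        gcongr
        refine hz0.trans ?_
        gcongr
        exact (abs_apply_zero_le_norm _).trans (h.norm_le k hk)
      _ = A * C ^ 3 * Y k + C ^ 2 * 1 := by ring
      _ ≤ A * C ^ 3 * Y k + C ^ 3 * Y k := by
        gcongr
        · norm_num
      _ = _ := by ring
  have hfin : (Y k : ℝ) ^ (Real.goldenRatio - 1) ≤ (A + 1) * C ^ 4 := by
    rw [Real.rpow_sub_one hYpos.ne', div_le_iff₀ hYpos]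
    calc (Y k : ℝ) ^ Real.goldenRatio ≤ C * Y (k + 1) := h.rpow_le_succ k hk
      _ ≤ C * ((A + 1) * C ^ 3 * Y k) := by gcongr
      _ = _ := by ring
  linarith

end IsApproxSequenceWith

theorem IsApproxSequence.exists_isDualSolution_Q {Y : ℕ → ℕ} {y : ℕ → Fin 3 → ℤ}
    (hs : IsApproxSequence ξ Y y) :
    ∃ c X₀ : ℝ, 0 < c ∧ 1 ≤ X₀ ∧ ∀ X : ℝ, X₀ ≤ X → ∃ k : ℕ, 1 ≤ k ∧
      (Q y k).natDegree = 2 ∧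
      IsDualSolution ξ c X ![(Q y k).coeff 2, (Q y k).coeff 1, (Q y k).coeff 0] := by
  obtain ⟨C, h⟩ := hs.exists_isApproxSequenceWith
  have hC := h.one_le
  have hg : 0 < Real.goldenRatio - 1 := by linarith [Real.one_lt_goldenRatio]
  have hlim : Filter.Tendsto (fun k => (Y k : ℝ) ^ (Real.goldenRatio - 1))
      Filter.atTop Filter.atTop := by
    refine (tendsto_rpow_atTop hg).comp (tendsto_natCast_atTop_atTop.comp ?_)
    exact Filter.tendsto_atTop_mono' _ ((Filter.eventually_ge_atTop 1).mono fun k hk =>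
      hs.le_apply hk) Filter.tendsto_id
  obtain ⟨k₀, hk₀⟩ := Filter.eventually_atTop.1
    ((hlim.eventually_gt_atTop ((2 + |ξ| + ξ ^ 2) * C ^ 4)).and (Filter.eventually_ge_atTop 1))
  have hk₀1 : 1 ≤ k₀ := (hk₀ k₀ le_rfl).2
  -- `B * Y k ^ (γ - 1)` bounds the coefficients of `Q y k`, and `D * Y k` is at least
  -- `B * Y (k + 1) ^ (γ - 1)`, as `Y (k + 1)` is about `Y k ^ γ` and `γ * (γ - 1) = 1`.
  set B := 2 * C ^ 3 with hB
  set D := B * C with hD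
  have hBpos : 0 < B := by positivity
  have hDpos : 0 < D := by positivity
  refine ⟨B * D ^ (Real.goldenRatio ^ 2), max 1 (B * (Y k₀ : ℝ) ^ (Real.goldenRatio - 1)),
    by positivity, le_max_left _ _, fun X hX => ?_⟩
  have hXpos : 0 < X := zero_lt_one.trans_le ((le_max_left _ _).trans hX)
  obtain ⟨k, hk, hkX, hXk⟩ : ∃ k, k₀ ≤ k ∧ B * (Y k : ℝ) ^ (Real.goldenRatio - 1) ≤ X ∧
      X < B * (Y (k + 1) : ℝ) ^ (Real.goldenRatio - 1) := by
    by_contra! hcon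
    have hall : ∀ k, k₀ ≤ k → B * (Y k : ℝ) ^ (Real.goldenRatio - 1) ≤ X := fun k hk => by
      induction k, hk using Nat.le_induction with
      | base => exact (le_max_right _ _).trans hX
      | succ k hk ih => exact hcon k hk ih
    obtain ⟨k, hk, hk'⟩ := ((hlim.eventually_gt_atTop (X / B)).and
      (Filter.eventually_ge_atTop k₀)).exists
    rw [div_lt_iff₀' hBpos] at hk
    exact absurd (hall k hk') (not_le.2 hk)
  have hk1 : 1 ≤ k := hk₀1.trans hk
  have hYpos : (0 : ℝ) < Y k := by linarith [h.one_le_cast k hk1]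
  have hlead := h.leadingCoeff_ne_zero hk1 (hk₀ k hk).1
  have hXD : X ≤ D * Y k := by
    refine hXk.le.trans ?_
    have h1 : (Y (k + 1) : ℝ) ^ (Real.goldenRatio - 1)
        ≤ (C * (Y k : ℝ) ^ Real.goldenRatio) ^ (Real.goldenRatio - 1) :=
      Real.rpow_le_rpow (by positivity) (h.succ_le_rpow k hk1) hg.le
    have h2 : C ^ (Real.goldenRatio - 1) ≤ C := by
      conv_rhs => rw [← Real.rpow_one C]
      exact Real.rpow_le_rpow_of_exponent_le hC (by linarith [Real.goldenRatio_lt_two])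
    have h3 : ((Y k : ℝ) ^ Real.goldenRatio) ^ (Real.goldenRatio - 1) = Y k := by
      rw [← Real.rpow_mul hYpos.le]
      have : Real.goldenRatio * (Real.goldenRatio - 1) = 1 := by
        linear_combination Real.goldenRatio_sq
      rw [this, Real.rpow_one]
    rw [Real.mul_rpow (by positivity) (by positivity), h3] at h1
    rw [hD, mul_assoc B]
    exact mul_le_mul_of_nonneg_left (h1.trans (by gcongr)) hBpos.le
  refine ⟨k, hk1, natDegree_Q hlead, ?_, ?_, ?_, ?_⟩
  · intro h0
    have := congrFun h0 0
    rw [Matrix.cons_val_zero, Q_coeff_two] at this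
    exact hlead this
  · rw [Matrix.cons_val_zero, Q_coeff_two]
    push_cast
    exact (abs_minor_one_le ξ _ _).trans ((h.minor_bound_le hk1).trans hkX)
  · rw [Matrix.cons_val_one, Matrix.cons_val_zero, Q_coeff_one]
    push_cast
    rw [abs_neg]
    exact (abs_minor_two_le ξ _ _).trans ((h.minor_bound_le hk1).trans hkX)
  · have hval := (abs_det_moment_le ξ (y k) (y (k + 1))).trans (h.L_mul_L_le hk1)
    simp only [Matrix.cons_val, Q_coeff_two, Q_coeff_one, Q_coeff_zero]
    push_cast
    rw [neg_mul, ← sub_eq_add_neg]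
    refine hval.trans ?_
    change B * _ ≤ _
    rw [mul_assoc B]
    refine mul_le_mul_of_nonneg_left ?_ hBpos.le
    rw [Real.rpow_neg hYpos.le, Real.rpow_neg hXpos.le, ← div_eq_mul_inv,
      le_div_iff₀ (by positivity), inv_mul_le_iff₀ (by positivity),
      mul_comm, ← Real.mul_rpow hDpos.le hYpos.le]
    exact Real.rpow_le_rpow hXpos.le hXD (by positivity)

end Roy

theorem theorem1p2 (ξ : ℝ) (hξ : Roy.IsExtremal ξ) :
    (∃ c : ℝ, 0 < c ∧ ∀ X : ℝ, 1 ≤ X → ∃ x : Fin 3 → ℤ, Roy.IsDualSolution ξ c X x) ∧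
    (∃ (Y : ℕ → ℕ) (y : ℕ → Fin 3 → ℤ), Roy.IsApproxSequence ξ Y y) ∧
    (∀ (Y : ℕ → ℕ) (y : ℕ → Fin 3 → ℤ), Roy.IsApproxSequence ξ Y y →
      ∃ c X₀ : ℝ, 0 < c ∧ 1 ≤ X₀ ∧ ∀ X : ℝ, X₀ ≤ X → ∃ k : ℕ, 1 ≤ k ∧
        (Roy.Q y k).natDegree = 2 ∧
        Roy.IsDualSolution ξ c X
          ![(Roy.Q y k).coeff 2, (Roy.Q y k).coeff 1, (Roy.Q y k).coeff 0]) := by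
  obtain ⟨K, x, hx⟩ := hξ.exists_isExtremalSequence
  have hseq := hx.exists_isApproxSequence hξ.2.1
  refine ⟨?_, hseq, fun Y y hs => hs.exists_isDualSolution_Q⟩
  obtain ⟨Y, y, hs⟩ := hseq
  obtain ⟨c, X₀, hc, hX₀, hsol⟩ := hs.exists_isDualSolution_Q
  refine ⟨max c (X₀ ^ (Real.goldenRatio ^ 2)), lt_max_of_lt_left hc, fun X hX => ?_⟩
  have hXpos : 0 < X := zero_lt_one.trans_le hX
  rcases le_or_gt X₀ X with h | h
  · obtain ⟨k, -, -, h1, h2, h3, h4⟩ := hsol X h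
    exact ⟨_, h1, h2, h3, h4.trans (by gcongr; exact le_max_left _ _)⟩
  -- For `X < X₀` the constant polynomial `1` serves, the constant being large enough.
  · refine ⟨![0, 0, 1], fun h0 => by simpa using congrFun h0 2, by simp [hXpos.le],
      by simp [hXpos.le], ?_⟩
    have h1 : X ^ (Real.goldenRatio ^ 2) ≤ max c (X₀ ^ (Real.goldenRatio ^ 2)) :=
      (Real.rpow_le_rpow hXpos.le h.le (by positivity)).trans (le_max_right _ _)
    rw [Real.rpow_neg hXpos.le, ← div_eq_mul_inv, le_div_iff₀ (by positivity)]
    simpa using h1
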